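/- Let $\mathcal V$ be a symmetric monoidal category, with monoidal product $\otimes$, unit $I$ and symmetry $\sigma$. A *semi-Hopf $\mathcal V$-category* $A$ is a category with a (small) set of objects $A^0$ enriched in the monoidal category of coalgebras in $\mathcal V$. Explicitly, it is a $\mathcal V$-category with Hom-objects $A_{xy}$, compositions $m_{xyz}\colon A_{xy}\otimes A_{yz}\to A_{xz}$ and units $j_x\colon I\to A_{xx}$, in which every $A_{xy}$ is a coassociative counital coalgebra $(A_{xy},\delta_{xy},\epsilon_{xy})$ in $\mathcal V$ and all $m_{xyz}$ and $j_x$ are coalgebra morphisms. With the $\mathcal V$-functors all of whose components are coalgebra morphisms, semi-Hopf $\mathcal V$-categories form a category $\mathcal V\text{-}\mathsf{sHopf}$. An *antipode* for $A$ is a family of morphisms $S_{xy}\colon A_{xy}\to A_{yx}$ in $\mathcal V$ with $$m_{xyx}\circ(\mathrm{id}\otimes S_{xy})\circ\delta_{xy}=j_x\circ\epsilon_{xy},\qquad m_{yxy}\circ(S_{xy}\otimes \mathrm{id})\circ\delta_{xy}=j_y\circ\epsilon_{xy}\qquad\text{for all }x,y\in A^0 .$$ Let $\mathcal V\text{-}\mathsf{Hopf}$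 be the full subcategory of $\mathcal V\text{-}\mathsf{sHopf}$ on the semi-Hopf $\mathcal V$-categories that admit an antipode (the Hopf $\mathcal V$-categories). The monoidal product of $\mathcal V$ is *very flat* if for every object $A$ and every nonempty jointly monic family $(\beta_i\colon B\to B_i)_{i\in\mathcal I}$ in $\mathcal V$ the family $(\beta_i\otimes\mathrm{id}_A\colon B\otimes A\to B_i\otimes A)_{i\in\mathcal I}$ is jointly monic. **Proposition.** Let $\mathcal V$ be a symmetric monoidal and locally presentable category. 1. If $\mathcal V$ is monoidal closed, then $\mathcal V\text{-}\mathsf{Hopf}$ is a cocomplete full subcategory of $\mathcal V\text{-}\mathsf{sHopf}$: it has all small colimits, the inclusion into $\mathcal V\text{-}\mathsf{sHopf}$ preserves them, and $\mathcal V\text{-}\mathsf{Hopf}$ is closed under small colimits in $\mathcal V\text{-}\mathsf{sHopf}$, that is, every colimit in $\mathcal V\text{-}\mathsf{sHopf}$ of a small diagram of Hopf $\mathcal V$-categories is a Hopf $\mathcal V$-category. 2. If the monoidal product of $\mathcal V$ is very flat, then $\mathcal V\text{-}\mathsf{Hopf}$ is a complete full subcategory of $\mathcal V\text{-}\mathsf{sHopf}$: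 it has all small limits, the inclusion into $\mathcal V\text{-}\mathsf{sHopf}$ preserves them, and $\mathcal V\text{-}\mathsf{Hopf}$ is closed under small limits in $\mathcal V\text{-}\mathsf{sHopf}$, that is, every limit in $\mathcal V\text{-}\mathsf{sHopf}$ of a small diagram of Hopf $\mathcal V$-categories is a Hopf $\mathcal V$-category. -/

import Mathlib

open CategoryTheory MonoidalCategory Limits
open scoped ComonObj

universe v u

/-- A family of morphisms with common domain `B` is jointly monic if two parallel morphisms into
`B` are equal as soon as they become equal after composition with every member of the family. -/
def JointlyMonic {V : Type u} [Category.{v} V] {B : V} {ι : Type v} {X : ι → V}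
    (β : ∀ i, B ⟶ X i) : Prop :=
  ∀ ⦃W : V⦄ (g h : W ⟶ B), (∀ i, g ≫ β i = h ≫ β i) → g = h

/-- The monoidal product of `V` is very flat: for every object `A`, the functor `- ⊗ A` preserves
(nonempty) jointly monic families. Empty families are left out: in the category of sets the empty
family on the singleton is jointly monic, but the empty family on `{*} × A` in general is not,
although the cartesian product of sets is to be very flat. -/
def VeryFlatTensor (V : Type u) [Category.{v} V] [MonoidalCategory V] : Prop :=
  ∀ (A B : V) (ι : Type v) [Nonempty ι] (X : ι → V) (β : ∀ i, B ⟶ X i),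
    JointlyMonic β → JointlyMonic (fun i => β i ▷ A)

/-- A semi-Hopf `V`-category over a symmetric (or braided) monoidal category `V`: a `V`-category
with a set of objects, all of whose Hom-objects are coalgebras in `V`, such that the compositions
`A x y ⊗ A y z ⟶ A x z` and units `𝟙_ V ⟶ A x x` are morphisms of coalgebras. -/
structure SemiHopfCat (V : Type u) [Category.{v} V] [MonoidalCategory V] [BraidedCategory V] where
  /-- The set of objects. -/
  carrier : Type v
  /-- The `V`-category structure. -/
  [enriched : EnrichedCategory V carrier]
  /-- The coalgebra structure of each Hom-object. -/
  [comon : ∀ x y : carrier, ComonObj (x ⟶[V] y)]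
  comp_comul : ∀ x y z : carrier,
    eComp V x y z ≫ Δ[x ⟶[V] z] =
      (Δ[x ⟶[V] y] ⊗ₘ Δ[y ⟶[V] z]) ≫
        tensorμ (x ⟶[V] y) (x ⟶[V] y) (y ⟶[V] z) (y ⟶[V] z) ≫
          (eComp V x y z ⊗ₘ eComp V x y z)
  comp_counit : ∀ x y z : carrier,
    eComp V x y z ≫ ε[x ⟶[V] z] = (ε[x ⟶[V] y] ⊗ₘ ε[y ⟶[V] z]) ≫ (λ_ (𝟙_ V)).hom
  id_comul : ∀ x : carrier,
    eId V x ≫ Δ[x ⟶[V] x] = (λ_ (𝟙_ V)).inv ≫ (eId V x ⊗ₘ eId V x)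
  id_counit : ∀ x : carrier, eId V x ≫ ε[x ⟶[V] x] = 𝟙 (𝟙_ V)

namespace SemiHopfCat

attribute [instance] enriched comon

variable {V : Type u} [Category.{v} V] [MonoidalCategory V] [BraidedCategory V]

/-- A semi-Hopf `V`-functor: a `V`-functor whose components are morphisms of coalgebras. -/
structure Hom (A B : SemiHopfCat V) where
  /-- The underlying `V`-functor. -/
  toFunctor : EnrichedFunctor V A.carrier B.carrier
  isComonHom : ∀ x y : A.carrier, IsComonHom (toFunctor.map x y)

attribute [instance] Hom.isComonHom

theorem Hom.ext_toFunctor {A B : SemiHopfCat V} {f g : Hom A B}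
    (h : f.toFunctor = g.toFunctor) : f = g := by
  cases f; cases g; cases h; rfl

/-- The category `V`-sHopf of semi-Hopf `V`-categories and semi-Hopf `V`-functors. -/
instance : Category.{v} (SemiHopfCat V) where
  Hom A B := Hom A B
  id A :=
    { toFunctor := EnrichedFunctor.id V A.carrier
      isComonHom := fun x y => inferInstanceAs (IsComonHom (𝟙 (x ⟶[V] y))) }
  comp f g :=
    { toFunctor := f.toFunctor.comp V g.toFunctor
      isComonHom := fun x y => inferInstanceAs
        (IsComonHom (f.toFunctor.map x y ≫ g.toFunctor.map _ _)) }
  id_comp _ := Hom.ext_toFunctor (EnrichedFunctor.ext V (fun _ => rfl)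
    (fun _ _ => (Category.comp_id _).trans (Category.id_comp _)))
  comp_id _ := Hom.ext_toFunctor (EnrichedFunctor.ext V (fun _ => rfl)
    (fun _ _ => (Category.comp_id _).trans (Category.comp_id _)))
  assoc _ _ _ := Hom.ext_toFunctor (EnrichedFunctor.ext V (fun _ => rfl)
    (fun _ _ => (Category.comp_id _).trans (Category.assoc _ _ _)))

/-- `S` is an antipode for the semi-Hopf `V`-category `A`. -/
def IsAntipode (A : SemiHopfCat V) (S : ∀ x y : A.carrier, (x ⟶[V] y) ⟶ (y ⟶[V] x)) : Prop :=
  ∀ x y : A.carrier,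
    Δ[x ⟶[V] y] ≫ ((x ⟶[V] y) ◁ S x y) ≫ eComp V x y x = ε[x ⟶[V] y] ≫ eId V x ∧
    Δ[x ⟶[V] y] ≫ (S x y ▷ (x ⟶[V] y)) ≫ eComp V y x y = ε[x ⟶[V] y] ≫ eId V y

end SemiHopfCat

/-- The property of semi-Hopf `V`-categories of being Hopf, that is, of admitting an antipode. -/
def isHopf (V : Type u) [Category.{v} V] [MonoidalCategory V] [BraidedCategory V] :
    ObjectProperty (SemiHopfCat V) :=
  fun A => ∃ S : ∀ x y : A.carrier, (x ⟶[V] y) ⟶ (y ⟶[V] x), A.IsAntipode S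

/-- The category `V`-Hopf: the full subcategory of `V`-sHopf on the Hopf `V`-categories. -/
abbrev HopfCat (V : Type u) [Category.{v} V] [MonoidalCategory V] [BraidedCategory V] :=
  (isHopf V).FullSubcategory

-- Both halves construct the (co)limit of semi-Hopf categories by hand, put an antipode on it and
-- carry that antipode along the isomorphism to any other (co)limit. A full subcategory closed under
-- existing (co)limits then inherits them, and its inclusion preserves them. The common tool is
-- convolution: morphisms from a fixed comonoid to the Hom-objects of a `V`-category compose, an
-- antipode is a two-sided convolution inverse of the identities, and a left and a right inverse
-- coincide (`eq_of_conv_eq_convUnit`). This uniqueness shows that antipodes reverse compositions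
-- (`IsAntipode.eComp_comp`) and comultiplications (`IsAntipode.comp_comul`), and that semi-Hopf
-- functors commute with them (`IsAntipode.comp_onHom`).
--
-- Colimits. The objects are the colimit of the sets of objects. A Hom-object is the coproduct of
-- the tensor products of all words of composable letters from the diagram, modulo inserting units,
-- composing neighbours and applying functors of the diagram. These relations are comonoid
-- morphisms, so the quotient is a comonoid. Since `V` is closed, tensoring is compatible with this
-- presentation, and the Hom-objects out of `y` form the free right module over the diagram on one
-- generator at `y`. Composition, comparison functors and antipode all arise by extending a
-- generator to a suitable module, and equalities of module morphisms are checked on the generator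
-- (`equivariant_ext`). For the antipode, a letter `a` acts as composition with `S a`; this is a
-- right action because `S` reverses products. On a word the antipode laws follow by induction: the
-- convolution inverse of `p * q` is `q' * p'`.
--
-- Limits. The objects are the limit of the sets of objects, and the Hom-objects must be limits of
-- comonoids. Call a cone of comonoids separated if its iterated comultiplications followed by
-- projections are jointly monic. By very flatness the image of a cone in the product of all tensor
-- words is again a comonoid, so each cone has a separated quotient. Separated cones are subobjects
-- of one fixed object, hence form a small set up to isomorphism, and the separated quotient of
-- their coproduct is terminal (`ComonCone.exists_terminal`). An antipode is a comonoid morphism out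
-- of the co-opposite, so the given antipodes induce a morphism `s` on the limit. The convolution of
-- the identity with `s` is not known to be a comonoid morphism; it is compared with the unit on all
-- tensor words, using that in the comultiplication of `x₁ s(x₂)`, which is `x₁ s(x₄) ⊗ x₂ s(x₃)`,
-- the inner pair cancels after one projection.

universe w w'

/-! ### Completeness and well-poweredness of locally presentable categories -/

section Presentable

variable (V : Type u) [Category.{v} V] [IsLocallyPresentable.{v} V]

theorem IsLocallyPresentable.hasColimits : HasColimits V := by
  obtain ⟨κ, _, _⟩ := IsLocallyPresentable.exists_cardinal.{v} V
  infer_instance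

/-- A locally presentable category is complete, being reflective in a category of presheaves on a
small dense subcategory. -/
theorem IsLocallyPresentable.hasLimits : HasLimits V := by
  have := IsLocallyPresentable.hasColimits V
  obtain ⟨κ, _, _⟩ := IsLocallyPresentable.exists_cardinal.{v} V
  let P := isCardinalPresentable V κ
  let e := equivSmallModel.{v} P.FullSubcategory
  let A : SmallModel.{v} P.FullSubcategory ⥤ V := e.inverse ⋙ P.ι
  have : A.IsDense := inferInstance
  let L := (uliftYoneda.{v}).leftKanExtension A
  let adj : L ⊣ Presheaf.restrictedULiftYoneda.{v} A :=
    Presheaf.uliftYonedaAdjunction.{v} L (uliftYoneda.{v}.leftKanExtensionUnit A)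
  let : Reflective (Presheaf.restrictedULiftYoneda.{v} A) := { L := L, adj := adj }
  exact hasLimits_of_reflective (Presheaf.restrictedULiftYoneda.{v} A)

/-- A small strong generator is a detecting set, and a category with pullbacks and a small detecting
set is well-powered. This is what bounds the separated cones of comonoids by a small set. -/
theorem IsLocallyPresentable.wellPowered : WellPowered.{v} V := by
  have := IsLocallyPresentable.hasLimits V
  have := IsLocallyPresentable.hasColimits V
  obtain ⟨κ, _, _⟩ := IsLocallyPresentable.exists_cardinal.{v} V
  obtain ⟨P, _, hP, -⟩ :=
    (IsCardinalLocallyPresentable.iff_exists_isStrongGenerator V κ).1 inferInstance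
  refine wellPowered_of_isDetecting (𝒢 := P) ?_
  intro X Y f hf
  -- Detection concerns arbitrary `f` with unique liftings from generators. Uniqueness makes `f`
  -- monic, and for monomorphisms existence of liftings suffices.
  have : Mono f := (hP.isSeparating.mono_iff f).2 fun G hG g h hgh =>
    (hf G hG (g ≫ f)).unique rfl hgh.symm
  exact hP.isIso_of_mono f fun G hG g => (hf G hG g).exists

end Presentable

/-! ### Factorization into strong epimorphisms and monomorphisms -/

section Factorization

variable {V : Type u} [Category.{v} V]

/-- In a complete well-powered category every morphism is a strong epimorphism followed by a
monomorphism. -/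
theorem exists_strongEpi_mono_factorization [HasLimits V] [WellPowered.{v} V] {X Y : V}
    (f : X ⟶ Y) : ∃ (E : V) (e : X ⟶ E) (m : E ⟶ Y), StrongEpi e ∧ Mono m ∧ e ≫ m = f := by
  -- `E` will be the intersection of all subobjects through which `f` factors, a small wide pullback
  -- by well-poweredness.
  let K := Shrink.{v} {S : Subobject Y // S.Factors f}
  let g : K → Subobject Y := fun k => ((equivShrink _).symm k).1
  have hg : ∀ k, (g k).Factors f := fun k => ((equivShrink _).symm k).2
  let E := widePullback.{v} Y (fun k => ((g k : Subobject Y) : V)) (fun k => (g k).arrow)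
  let m : E ⟶ Y := WidePullback.base _
  let e : X ⟶ E := WidePullback.lift f (fun k => (g k).factorThru f (hg k)) (by simp)
  have fac : e ≫ m = f := WidePullback.lift_base _ _ _ _
  have hm : Mono m := ⟨fun a b h => by
    refine WidePullback.hom_ext _ _ _ (fun k => ?_) h
    rw [← cancel_mono (g k).arrow, Category.assoc, Category.assoc, WidePullback.π_arrow]
    exact h⟩
  -- a monomorphism into `E` through which `e` factors is split
  have key : ∀ {Z : V} (n : Z ⟶ E) [Mono n] (a : X ⟶ Z), a ≫ n = e → ∃ s : E ⟶ Z, s ≫ n = 𝟙 E := by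
    intro Z n _ a ha
    have hS : (Subobject.mk (n ≫ m)).Factors f :=
      (Subobject.mk_factors_iff _ _).2 ⟨a, by simp [reassoc_of% ha, fac]⟩
    let k : K := equivShrink _ ⟨Subobject.mk (n ≫ m), hS⟩
    have hk : g k = Subobject.mk (n ≫ m) := by simp [g, k]
    refine ⟨WidePullback.π _ k ≫ eqToHom (by rw [hk]) ≫ (Subobject.underlyingIso (n ≫ m)).hom, ?_⟩
    rw [← cancel_mono m]
    have h2 : ∀ (S T : Subobject Y) (h : S = T), eqToHom (by rw [h]) ≫ T.arrow = S.arrow := by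
      rintro S _ rfl; simp
    simp only [Category.assoc, Subobject.underlyingIso_hom_comp_eq_mk, Category.id_comp]
    rw [h2 _ _ hk, WidePullback.π_arrow]
  -- If `e` equalizes `a` and `b`, it factors through their equalizer, which therefore has a
  -- section.
  have he : Epi e := ⟨fun {Z} a b h => by
    obtain ⟨s, hs⟩ := key (equalizer.ι a b) (equalizer.lift e h) (by simp)
    rw [← Category.id_comp a, ← Category.id_comp b, ← hs, Category.assoc, Category.assoc,
      equalizer.condition]⟩
  refine ⟨E, e, m, ⟨he, fun {Z W} z hz => ⟨fun {a b} sq => ?_⟩⟩, hm, fac⟩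
  -- The pullback of the monomorphism `z` along `b` is a monomorphism through which `e` factors; its
  -- section followed by the other projection is the diagonal filler.
  obtain ⟨s, hs⟩ := key (pullback.snd z b) (pullback.lift a e sq.w) (pullback.lift_snd _ _ _)
  refine ⟨⟨⟨s ≫ pullback.fst z b, ?_, ?_⟩⟩⟩
  · rw [← cancel_mono z]
    simp only [Category.assoc, pullback.condition, reassoc_of% hs, sq.w]
  · simp only [Category.assoc, pullback.condition, reassoc_of% hs]

end Factorization

/-! ### Components of semi-Hopf functors; invariance of being Hopf under isomorphism -/

namespace SemiHopfCat

variable {V : Type u} [Category.{v} V] [MonoidalCategory V] [BraidedCategory V]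

/-- The action of a semi-Hopf functor on objects. -/
def onObj {A B : SemiHopfCat V} (F : A ⟶ B) : A.carrier → B.carrier :=
  (show Hom A B from F).toFunctor.obj

/-- The component of a semi-Hopf functor at `x` and `y`, with its codomain transported along
equalities of objects. -/
def onHom {A B : SemiHopfCat V} (F : A ⟶ B) {x y : A.carrier} {x' y' : B.carrier}
    (hx : onObj F x = x') (hy : onObj F y = y') : (x ⟶[V] y) ⟶ (x' ⟶[V] y') :=
  (show Hom A B from F).toFunctor.map x y ≫ eqToHom (by rw [← hx, ← hy]; rfl)

theorem onHom_rfl {A B : SemiHopfCat V} (F : A ⟶ B) (x y : A.carrier) :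
    onHom F (rfl : onObj F x = _) (rfl : onObj F y = _) =
      (show Hom A B from F).toFunctor.map x y :=
  Category.comp_id _

instance onHom_isComonHom {A B : SemiHopfCat V} (F : A ⟶ B) {x y : A.carrier} {x' y' : B.carrier}
    (hx : onObj F x = x') (hy : onObj F y = y') : IsComonHom (onHom F hx hy) := by
  subst hx hy
  rw [onHom_rfl]
  exact (show Hom A B from F).isComonHom x y

theorem onHom_id {A B : SemiHopfCat V} (F : A ⟶ B) {x : A.carrier} {x' : B.carrier}
    (hx hx₁ : onObj F x = x') : eId V x ≫ onHom F hx hx₁ = eId V x' := by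
  subst hx
  rw [onHom_rfl]
  exact (show Hom A B from F).toFunctor.map_id x

theorem onHom_comp {A B : SemiHopfCat V} (F : A ⟶ B) {x y z : A.carrier} {x' y' z' : B.carrier}
    (hx : onObj F x = x') (hy : onObj F y = y') (hz : onObj F z = z') :
    eComp V x y z ≫ onHom F hx hz = (onHom F hx hy ⊗ₘ onHom F hy hz) ≫ eComp V x' y' z' := by
  subst hx hy hz
  rw [onHom_rfl, onHom_rfl, onHom_rfl]
  exact (show Hom A B from F).toFunctor.map_comp x y z

theorem onHom_onHom {A B C : SemiHopfCat V} (F : A ⟶ B) (G : B ⟶ C) {x y : A.carrier}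
    {x' y' : B.carrier} {x'' y'' : C.carrier}
    (hx : onObj F x = x') (hy : onObj F y = y') (hx' : onObj G x' = x'') (hy' : onObj G y' = y'')
    (hx₁ : onObj (F ≫ G) x = x'') (hy₁ : onObj (F ≫ G) y = y'') :
    onHom F hx hy ≫ onHom G hx' hy' = onHom (F ≫ G) hx₁ hy₁ := by
  subst hx hy hx' hy'
  rw [onHom_rfl, onHom_rfl]
  exact (onHom_rfl (F ≫ G) x y).symm

theorem onHom_congr {A B : SemiHopfCat V} {F G : A ⟶ B} (h : F = G) {x y : A.carrier}
    {x' y' : B.carrier} (hx : onObj F x = x') (hy : onObj F y = y')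
    (hx' : onObj G x = x') (hy' : onObj G y = y') : onHom F hx hy = onHom G hx' hy' := by
  subst h; rfl

theorem onHom_id_functor {A : SemiHopfCat V} (x y : A.carrier)
    (hx : onObj (𝟙 A) x = x) (hy : onObj (𝟙 A) y = y) : onHom (𝟙 A) hx hy = 𝟙 (x ⟶[V] y) :=
  onHom_rfl (𝟙 A) x y

theorem hom_ext {A B : SemiHopfCat V} {F G : A ⟶ B} (h : ∀ x, onObj F x = onObj G x)
    (h' : ∀ x y, onHom F (h x) (h y) = onHom G rfl rfl) : F = G :=
  Hom.ext_toFunctor (EnrichedFunctor.ext V h fun x y => (h' x y).trans (onHom_rfl G x y))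

/-- Being Hopf is invariant under isomorphism. -/
instance isHopf_isClosedUnderIsomorphisms : (isHopf V).IsClosedUnderIsomorphisms where
  of_iso {A B} e := by
    rintro ⟨S, hS⟩
    have hi : ∀ x : B.carrier, onObj e.hom (onObj e.inv x) = x := fun x =>
      congrArg (fun F : B ⟶ B => onObj F x) e.inv_hom_id
    have hcomp : ∀ x y : B.carrier,
        onHom e.inv (rfl : onObj e.inv x = _) (rfl : onObj e.inv y = _) ≫
          onHom e.hom (hi x) (hi y) = 𝟙 _ := fun x y =>
      (onHom_onHom e.inv e.hom rfl rfl (hi x) (hi y) (hi x) (hi y)).trans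
        ((onHom_congr e.inv_hom_id (hi x) (hi y) rfl rfl).trans (onHom_id_functor x y rfl rfl))
    refine ⟨fun x y => onHom e.inv rfl rfl ≫ S (onObj e.inv x) (onObj e.inv y) ≫
      onHom e.hom (hi y) (hi x), fun x y => ⟨?_, ?_⟩⟩
    · have h := onHom e.inv (rfl : onObj e.inv x = _) (rfl : onObj e.inv y = _) ≫=
        (hS (onObj e.inv x) (onObj e.inv y)).1 =≫ onHom e.hom (hi x) (hi x)
      simp only [Category.assoc, onHom_comp e.hom (hi x) (hi y) (hi x), onHom_id,
        IsComonHom.hom_comul_assoc, IsComonHom.hom_counit_assoc] at h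
      rw [← h, ← id_tensorHom, ← id_tensorHom]
      simp only [tensorHom_comp_tensorHom_assoc, Category.id_comp, hcomp]
    · have h := onHom e.inv (rfl : onObj e.inv x = _) (rfl : onObj e.inv y = _) ≫=
        (hS (onObj e.inv x) (onObj e.inv y)).2 =≫ onHom e.hom (hi y) (hi y)
      simp only [Category.assoc, onHom_comp e.hom (hi y) (hi x) (hi y), onHom_id,
        IsComonHom.hom_comul_assoc, IsComonHom.hom_counit_assoc] at h
      rw [← h, ← tensorHom_id, ← tensorHom_id]
      simp only [tensorHom_comp_tensorHom_assoc, Category.id_comp, hcomp]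

end SemiHopfCat

/-! ### Tensor products of comonoids -/

section ComonoidTensor

variable {V : Type u} [Category.{v} V] [MonoidalCategory V] [BraidedCategory V]

instance tensorHom_isComonHom {C D C' D' : V} [ComonObj C] [ComonObj D] [ComonObj C'] [ComonObj D']
    (f : C ⟶ C') (g : D ⟶ D') [IsComonHom f] [IsComonHom g] : IsComonHom (f ⊗ₘ g) :=
  (MonoidalCategory.tensorHom (C := Comon V) (X₁ := ⟨C⟩) (Y₁ := ⟨C'⟩) (X₂ := ⟨D⟩) (Y₂ := ⟨D'⟩)
    (Comon.Hom.mk f) (Comon.Hom.mk g)).isComonHom_hom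

instance whiskerRight_isComonHom {C C' : V} [ComonObj C] [ComonObj C']
    (f : C ⟶ C') (D : V) [ComonObj D] [IsComonHom f] : IsComonHom (f ▷ D) := by
  rw [← tensorHom_id]; infer_instance

instance whiskerLeft_isComonHom {D D' : V} (C : V) [ComonObj C] [ComonObj D] [ComonObj D']
    (g : D ⟶ D') [IsComonHom g] : IsComonHom (C ◁ g) := by
  rw [← id_tensorHom]; infer_instance

instance associator_hom_isComonHom (C D E : V) [ComonObj C] [ComonObj D] [ComonObj E] :
    IsComonHom (α_ C D E).hom := by
  have h : (α_ (Comon.mk C) (Comon.mk D) (Comon.mk E)).hom.hom = (α_ C D E).hom :=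
    (Comon.monoidal_associator_hom_hom V (Comon.mk C) (Comon.mk D) (Comon.mk E)).trans (by
      change 𝟙 (C ⊗ D) ▷ E ≫ _ ≫ C ◁ 𝟙 (D ⊗ E) = _
      rw [id_whiskerRight, MonoidalCategory.whiskerLeft_id, Category.comp_id, Category.id_comp])
  exact h ▸ (α_ (Comon.mk C) (Comon.mk D) (Comon.mk E)).hom.isComonHom_hom

attribute [local instance] ComonObj.instTensorUnit

instance leftUnitor_hom_isComonHom (C : V) [ComonObj C] : IsComonHom (λ_ C).hom := by
  have h : (λ_ (Comon.mk C)).hom.hom = (λ_ C).hom :=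
    (Comon.monoidal_leftUnitor_hom_hom V (Comon.mk C)).trans (by
      change 𝟙 (𝟙_ V) ▷ C ≫ _ = _
      rw [id_whiskerRight, Category.id_comp])
  exact h ▸ (λ_ (Comon.mk C)).hom.isComonHom_hom

instance rightUnitor_hom_isComonHom (C : V) [ComonObj C] : IsComonHom (ρ_ C).hom := by
  have h : (ρ_ (Comon.mk C)).hom.hom = (ρ_ C).hom :=
    (Comon.monoidal_rightUnitor_hom_hom V (Comon.mk C)).trans (by
      change C ◁ 𝟙 (𝟙_ V) ≫ _ = _
      rw [MonoidalCategory.whiskerLeft_id, Category.id_comp])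
  exact h ▸ (ρ_ (Comon.mk C)).hom.isComonHom_hom

instance counit_isComonHom (C : V) [ComonObj C] : IsComonHom ε[C] :=
  (Comon.uniqueHomToTrivial (Comon.mk C)).default.isComonHom_hom

variable (C D : V) [ComonObj C] [ComonObj D]

/-- The first projection of a tensor product of comonoids. -/
def tensorFst : C ⊗ D ⟶ C := C ◁ ε[D] ≫ (ρ_ C).hom

/-- The second projection of a tensor product of comonoids. -/
def tensorSnd : C ⊗ D ⟶ D := ε[C] ▷ D ≫ (λ_ D).hom

instance : IsComonHom (tensorFst C D) :=
  inferInstanceAs (IsComonHom (C ◁ ε[D] ≫ (ρ_ C).hom))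

instance : IsComonHom (tensorSnd C D) :=
  inferInstanceAs (IsComonHom (ε[C] ▷ D ≫ (λ_ D).hom))

/-- The counits kill the two inner factors, so the braiding in the comultiplication becomes that of
the unit with itself, which is trivial. With this, a morphism out of a tensor product becomes a
convolution of morphisms out of its factors. -/
theorem comul_fst_snd : Δ[C ⊗ D] ≫ (tensorFst C D ⊗ₘ tensorSnd C D) = 𝟙 (C ⊗ D) := by
  have h : tensorFst C D ⊗ₘ tensorSnd C D =
      ((𝟙 C ⊗ₘ ε[D]) ⊗ₘ (ε[C] ⊗ₘ 𝟙 D)) ≫ ((ρ_ C).hom ⊗ₘ (λ_ D).hom) := by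
    simp [tensorFst, tensorSnd]
  rw [h, Comon.tensorObj_comul, Category.assoc, ← tensorμ_natural_assoc,
    tensorHom_comp_tensorHom_assoc]
  simp only [ComonObj.comul_counit_hom, ComonObj.counit_comul_hom, Category.id_comp]
  have : (β_ (𝟙_ V) (𝟙_ V)).hom = 𝟙 _ := by
    rw [braiding_tensorUnit_left, ← unitors_inv_equal, Iso.hom_inv_id]
  rw [tensorμ, this]
  monoidal

/-- Here the counits kill the outer factors and the braiding survives. Convolving projections in the
wrong order thus produces the reversed product appearing in the laws of antipodes. -/
theorem comul_snd_fst : Δ[C ⊗ D] ≫ (tensorSnd C D ⊗ₘ tensorFst C D) = (β_ C D).hom := by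
  have h : tensorSnd C D ⊗ₘ tensorFst C D =
      ((ε[C] ⊗ₘ 𝟙 D) ⊗ₘ (𝟙 C ⊗ₘ ε[D])) ≫ ((λ_ D).hom ⊗ₘ (ρ_ C).hom) := by
    simp [tensorFst, tensorSnd]
  rw [h, Comon.tensorObj_comul, Category.assoc, ← tensorμ_natural_assoc,
    tensorHom_comp_tensorHom_assoc]
  simp only [ComonObj.comul_counit_hom, ComonObj.counit_comul_hom, Category.id_comp]
  simp only [tensorμ, Category.assoc]
  monoidal

end ComonoidTensor

/-! ### Convolution -/

section Convolution

variable {V : Type u} [Category.{v} V] [MonoidalCategory V]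

/-- The convolution of two morphisms from a comonoid to composable Hom-objects of a
`V`-category. -/
def conv {C : V} [ComonObj C] {B : Type w} [EnrichedCategory V B] {x y z : B}
    (f : C ⟶ (x ⟶[V] y)) (g : C ⟶ (y ⟶[V] z)) : C ⟶ (x ⟶[V] z) :=
  Δ[C] ≫ (f ⊗ₘ g) ≫ eComp V x y z

/-- The identities for convolution. -/
def convUnit (C : V) [ComonObj C] {B : Type w} [EnrichedCategory V B] (x : B) :
    C ⟶ (x ⟶[V] x) :=
  ε[C] ≫ eId V x

section

variable {C : V} [ComonObj C] {B : Type w} [EnrichedCategory V B]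

theorem convUnit_conv {x y : B} (f : C ⟶ (x ⟶[V] y)) : conv (convUnit C x) f = f := by
  have : convUnit C x ⊗ₘ f = (ε[C] ⊗ₘ f) ≫ eId V x ▷ _ := by
    rw [convUnit, ← tensorHom_id, tensorHom_comp_tensorHom, Category.comp_id]
  rw [conv, this]
  simp

theorem conv_convUnit {x y : B} (f : C ⟶ (x ⟶[V] y)) : conv f (convUnit C y) = f := by
  have : f ⊗ₘ convUnit C y = (f ⊗ₘ ε[C]) ≫ _ ◁ eId V y := by
    rw [convUnit, ← id_tensorHom, tensorHom_comp_tensorHom, Category.comp_id]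
  rw [conv, this]
  simp

theorem conv_assoc {x y z t : B} (f : C ⟶ (x ⟶[V] y)) (g : C ⟶ (y ⟶[V] z))
    (h : C ⟶ (z ⟶[V] t)) : conv (conv f g) h = conv f (conv g h) := by
  have h₁ : conv f g ⊗ₘ h = Δ[C] ▷ C ≫ ((f ⊗ₘ g) ⊗ₘ h) ≫ eComp V x y z ▷ _ := by
    simp only [conv, ← tensorHom_id, tensorHom_comp_tensorHom, Category.id_comp,
      Category.comp_id]
  have h₂ : f ⊗ₘ conv g h = C ◁ Δ[C] ≫ (f ⊗ₘ (g ⊗ₘ h)) ≫ _ ◁ eComp V y z t := by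
    simp only [conv, ← id_tensorHom, tensorHom_comp_tensorHom, Category.id_comp,
      Category.comp_id]
  rw [conv, h₁]
  conv_rhs => rw [conv, h₂]
  simp only [Category.assoc, ← e_assoc, ComonObj.comul_assoc_assoc]
  simp

theorem comp_conv {D : V} [ComonObj D] (φ : D ⟶ C) [IsComonHom φ] {x y z : B}
    (f : C ⟶ (x ⟶[V] y)) (g : C ⟶ (y ⟶[V] z)) : φ ≫ conv f g = conv (φ ≫ f) (φ ≫ g) := by
  simp [conv]

theorem comp_convUnit {D : V} [ComonObj D] (φ : D ⟶ C) [IsComonHom φ] (x : B) :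
    φ ≫ convUnit C x = convUnit D x := by
  simp [convUnit]

/-- Only compatibility with one composition is required of `p`, `q`, `r`, so that functor components
transported along object equalities, letters, pairings and inclusions into a product category are
all covered. -/
theorem conv_comp {B' : Type w'} [EnrichedCategory V B'] {x y z : B} {x' y' z' : B'}
    (f : C ⟶ (x ⟶[V] y)) (g : C ⟶ (y ⟶[V] z)) (p : (x ⟶[V] y) ⟶ (x' ⟶[V] y'))
    (q : (y ⟶[V] z) ⟶ (y' ⟶[V] z')) (r : (x ⟶[V] z) ⟶ (x' ⟶[V] z'))
    (h : eComp V x y z ≫ r = (p ⊗ₘ q) ≫ eComp V x' y' z') :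
    conv f g ≫ r = conv (f ≫ p) (g ≫ q) := by
  simp [conv, h]

/-- Left and right inverses for convolution agree. -/
theorem eq_of_conv_eq_convUnit {x y : B} {f : C ⟶ (x ⟶[V] y)} {g h : C ⟶ (y ⟶[V] x)}
    (hg : conv g f = convUnit C y) (hh : conv f h = convUnit C x) : g = h := by
  rw [← conv_convUnit g, ← hh, ← conv_assoc, hg, convUnit_conv]

end

variable [BraidedCategory V] {C D : V} [ComonObj C] [ComonObj D]
  {B : Type w} [EnrichedCategory V B] {x y z : B}

theorem conv_fst_snd (f : C ⟶ (x ⟶[V] y)) (g : D ⟶ (y ⟶[V] z)) :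
    conv (tensorFst C D ≫ f) (tensorSnd C D ≫ g) = (f ⊗ₘ g) ≫ eComp V x y z := by
  rw [conv, ← tensorHom_comp_tensorHom, Category.assoc, reassoc_of% @comul_fst_snd]

theorem conv_snd_fst (g : D ⟶ (x ⟶[V] y)) (f : C ⟶ (y ⟶[V] z)) :
    conv (tensorSnd C D ≫ g) (tensorFst C D ≫ f) =
      (β_ C D).hom ≫ (g ⊗ₘ f) ≫ eComp V x y z := by
  rw [conv, ← tensorHom_comp_tensorHom, Category.assoc, reassoc_of% @comul_snd_fst]

end Convolution

/-! ### Properties of antipodes -/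

namespace SemiHopfCat

variable {V : Type u} [Category.{v} V] [MonoidalCategory V] [BraidedCategory V]

attribute [local instance] ComonObj.instTensorUnit

instance eComp_isComonHom (A : SemiHopfCat V) (x y z : A.carrier) : IsComonHom (eComp V x y z) where
  hom_counit := A.comp_counit x y z
  hom_comul := by
    rw [A.comp_comul x y z, Comon.tensorObj_comul, Category.assoc]

instance eId_isComonHom (A : SemiHopfCat V) (x : A.carrier) : IsComonHom (eId V x) where
  hom_counit := A.id_counit x
  hom_comul := A.id_comul x

namespace IsAntipode

variable {A : SemiHopfCat V} {S : ∀ x y : A.carrier, (x ⟶[V] y) ⟶ (y ⟶[V] x)}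

theorem conv_right (hS : A.IsAntipode S) (x y : A.carrier) :
    conv (𝟙 (x ⟶[V] y)) (S x y) = convUnit _ x := by
  rw [conv, convUnit, ← (hS x y).1, id_tensorHom]

theorem conv_left (hS : A.IsAntipode S) (x y : A.carrier) :
    conv (S x y) (𝟙 (x ⟶[V] y)) = convUnit _ y := by
  rw [conv, convUnit, ← (hS x y).2, tensorHom_id]

theorem conv_right_of_isComonHom (hS : A.IsAntipode S) {C : V} [ComonObj C] {x y : A.carrier}
    (f : C ⟶ (x ⟶[V] y)) [IsComonHom f] : conv f (f ≫ S x y) = convUnit C x := by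
  rw [← comp_convUnit f, ← hS.conv_right x y, comp_conv, Category.comp_id]

theorem conv_left_of_isComonHom (hS : A.IsAntipode S) {C : V} [ComonObj C] {x y : A.carrier}
    (f : C ⟶ (x ⟶[V] y)) [IsComonHom f] : conv (f ≫ S x y) f = convUnit C y := by
  rw [← comp_convUnit f, ← hS.conv_left x y, comp_conv, Category.comp_id]

theorem of_conv (h₁ : ∀ x y, conv (𝟙 (x ⟶[V] y)) (S x y) = convUnit _ x)
    (h₂ : ∀ x y, conv (S x y) (𝟙 (x ⟶[V] y)) = convUnit _ y) : A.IsAntipode S := fun x y =>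
  ⟨by simpa [conv, convUnit] using h₁ x y, by simpa [conv, convUnit] using h₂ x y⟩

/-- An antipode reverses compositions. -/
theorem eComp_comp (hS : A.IsAntipode S) (x y z : A.carrier) :
    eComp V x y z ≫ S x z = (β_ _ _).hom ≫ (S y z ⊗ₘ S x y) ≫ eComp V z y x := by
  have h : eComp V x y z = conv (tensorFst _ _) (tensorSnd _ _) := by
    simpa using (conv_fst_snd (𝟙 (x ⟶[V] y)) (𝟙 (y ⟶[V] z))).symm
  rw [← conv_snd_fst]
  symm
  -- Both sides are convolution inverses of the composition: one because composition is a comonoid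
  -- morphism, the other by `S(b) S(a) a b = 1`.
  refine eq_of_conv_eq_convUnit (f := eComp V x y z) ?_ (hS.conv_right_of_isComonHom _)
  rw [h, conv_assoc, ← conv_assoc (tensorFst _ _ ≫ _), hS.conv_left_of_isComonHom, convUnit_conv,
    hS.conv_left_of_isComonHom]

/-- An antipode preserves units. -/
theorem eId_comp (hS : A.IsAntipode S) (x : A.carrier) : eId V x ≫ S x x = eId V x := by
  have h : eId V x = convUnit (𝟙_ V) x := (Category.id_comp _).symm
  rw [← convUnit_conv (eId V x ≫ S x x), ← h, hS.conv_right_of_isComonHom, h]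

/-- An antipode preserves counits. -/
theorem comp_counit (hS : A.IsAntipode S) (x y : A.carrier) :
    S x y ≫ ε[y ⟶[V] x] = ε[x ⟶[V] y] := by
  -- Apply the counit to `x₁ S(x₂) = ε(x) 1`; counits are multiplicative.
  have h := hS.conv_right x y =≫ ε
  simp only [conv, convUnit, Category.assoc, A.comp_counit, A.id_counit, Category.comp_id,
    tensorHom_comp_tensorHom_assoc, Category.id_comp] at h
  rwa [ComonObj.counit_comul_hom_assoc, Iso.inv_hom_id, Category.comp_id] at h

/-- Semi-Hopf functors commute with antipodes. -/
theorem comp_onHom {B : SemiHopfCat V} {S' : ∀ x y : B.carrier, (x ⟶[V] y) ⟶ (y ⟶[V] x)}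
    (hS : A.IsAntipode S) (hS' : B.IsAntipode S') (F : A ⟶ B) {x y : A.carrier} {x' y' : B.carrier}
    (hx : onObj F x = x') (hy : onObj F y = y') :
    S x y ≫ onHom F hy hx = onHom F hx hy ≫ S' x' y' := by
  refine eq_of_conv_eq_convUnit (f := onHom F hx hy) ?_ (hS'.conv_right_of_isComonHom _)
  have h := hS.conv_left x y =≫ onHom F hy hy
  rw [conv_comp _ _ _ _ _ (onHom_comp F hy hx hy), Category.id_comp] at h
  rw [h, convUnit, Category.assoc, onHom_id, convUnit]

end IsAntipode

end SemiHopfCat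

/-! ### Colimits: words, right modules and the Hom-objects of the colimit -/

noncomputable section

section JointlyEpi

variable {V : Type u} [Category.{v} V] [MonoidalCategory V] [MonoidalClosed V]
  {ι : Type*} {E : ι → V} {Q : V} (e : ∀ i, E i ⟶ Q)

/-- The functor `A ⊗ -` has a right adjoint, so currying reduces the claim to the original family.
-/
theorem jointlyEpi_whiskerLeft
    (he : ∀ {Z : V} (f g : Q ⟶ Z), (∀ i, e i ≫ f = e i ≫ g) → f = g) (A : V) {Z : V} (f g : A ⊗ Q ⟶ Z)
    (h : ∀ i, A ◁ e i ≫ f = A ◁ e i ≫ g) : f = g := by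
  apply MonoidalClosed.curry_injective
  refine he _ _ fun i => ?_
  rw [← MonoidalClosed.curry_natural_left, ← MonoidalClosed.curry_natural_left, h]

theorem jointlyEpi_whiskerRight [BraidedCategory V]
    (he : ∀ {Z : V} (f g : Q ⟶ Z), (∀ i, e i ≫ f = e i ≫ g) → f = g) (A : V) {Z : V} (f g : Q ⊗ A ⟶ Z)
    (h : ∀ i, e i ▷ A ≫ f = e i ▷ A ≫ g) : f = g := by
  rw [← cancel_epi (β_ _ _).hom]
  refine jointlyEpi_whiskerLeft e he A _ _ fun i => ?_
  rw [BraidedCategory.braiding_naturality_right_assoc,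
    BraidedCategory.braiding_naturality_right_assoc, h]

end JointlyEpi

namespace SemiHopfCat

variable {V : Type u} [Category.{v} V] [MonoidalCategory V] [BraidedCategory V]

attribute [local instance] ComonObj.instTensorUnit

variable {J : Type v} [SmallCategory J] (F : J ⥤ SemiHopfCat V)

/-- The colimit of the sets of objects of a diagram of semi-Hopf categories. -/
def ColimObj : Type v :=
  Quot (fun p q : Σ j, (F.obj j).carrier => ∃ f : p.1 ⟶ q.1, onObj (F.map f) p.2 = q.2)

variable {F}

/-- The class of an object in the colimit of the sets of objects. -/
def colimObj {j : J} (a : (F.obj j).carrier) : ColimObj F := Quot.mk _ ⟨j, a⟩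

theorem colimObj_map {j k : J} (f : j ⟶ k) (a : (F.obj j).carrier) :
    colimObj (onObj (F.map f) a) = colimObj a :=
  (Quot.sound ⟨f, rfl⟩).symm

variable (F)

/-- A right module over a diagram of semi-Hopf categories: a family of objects on which the
morphisms of all members of the diagram act compatibly. -/
structure RightModule where
  /-- The underlying family of objects. -/
  obj : ColimObj F → V
  /-- The action. -/
  act : ∀ {j : J} (a b : (F.obj j).carrier) {x z : ColimObj F} (_ : colimObj a = x)
    (_ : colimObj b = z), obj x ⊗ (a ⟶[V] b) ⟶ obj z
  act_id : ∀ {j : J} (a : (F.obj j).carrier) {x : ColimObj F} (hx : colimObj a = x),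
    obj x ◁ eId V a ≫ act a a hx hx = (ρ_ _).hom
  act_comp : ∀ {j : J} (a b c : (F.obj j).carrier) {x y z : ColimObj F} (hx : colimObj a = x)
    (hy : colimObj b = y) (hz : colimObj c = z),
    (α_ _ _ _).hom ≫ obj x ◁ eComp V a b c ≫ act a c hx hz =
      act a b hx hy ▷ _ ≫ act b c hy hz
  act_map : ∀ {j k : J} (f : j ⟶ k) (a b : (F.obj j).carrier) {x z : ColimObj F}
    (hx : colimObj a = x) (hz : colimObj b = z) (hx' : colimObj (onObj (F.map f) a) = x)
    (hz' : colimObj (onObj (F.map f) b) = z),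
    obj x ◁ onHom (F.map f) rfl rfl ≫ act (onObj (F.map f) a) (onObj (F.map f) b) hx' hz' =
      act a b hx hz

/-- Words of composable Hom-objects of members of the diagram, starting at `y`. -/
inductive Word (y : ColimObj F) : ColimObj F → Type v
  | nil : Word y y
  | snoc {x z : ColimObj F} (w : Word y x) (j : J) (a b : (F.obj j).carrier)
      (hx : colimObj a = x) (hz : colimObj b = z) : Word y z

variable {F}

namespace Word

variable {y : ColimObj F}

/-- The tensor product of the letters of a word. -/
def obj : ∀ {x : ColimObj F}, Word F y x → V
  | _, nil => 𝟙_ V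
  | _, snoc w _ a b _ _ => w.obj ⊗ (a ⟶[V] b)

/-- The tensor product of the letters of a word is a comonoid. -/
@[reducible]
def comon : ∀ {x : ColimObj F} (w : Word F y x), ComonObj w.obj
  | _, nil => inferInstanceAs (ComonObj (𝟙_ V))
  | _, snoc w _ a b _ _ =>
    letI := w.comon
    inferInstanceAs (ComonObj (w.obj ⊗ (a ⟶[V] b)))

attribute [instance] comon

/-- Elementary steps between words: insertion of a unit, composition of the last two letters,
application of a functor of the diagram to the last letter, and any of these before further
letters. -/
inductive Step : ∀ {x : ColimObj F}, Word F y x → Word F y x → Type v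
  | id {x : ColimObj F} (w : Word F y x) (j : J) (a : (F.obj j).carrier) (hx : colimObj a = x) :
      Step w (w.snoc j a a hx hx)
  | comp {x x' z : ColimObj F} (w : Word F y x) (j : J) (a b c : (F.obj j).carrier)
      (hx : colimObj a = x) (hx' : colimObj b = x') (hz : colimObj c = z) :
      Step ((w.snoc j a b hx hx').snoc j b c hx' hz) (w.snoc j a c hx hz)
  | map {x z : ColimObj F} (w : Word F y x) {j k : J} (f : j ⟶ k) (a b : (F.obj j).carrier)
      (hx : colimObj a = x) (hz : colimObj b = z) (hx' : colimObj (onObj (F.map f) a) = x)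
      (hz' : colimObj (onObj (F.map f) b) = z) :
      Step (w.snoc j a b hx hz) (w.snoc k (onObj (F.map f) a) (onObj (F.map f) b) hx' hz')
  | congr {x z : ColimObj F} {w w' : Word F y x} (s : Step w w') (j : J)
      (a b : (F.obj j).carrier) (hx : colimObj a = x) (hz : colimObj b = z) :
      Step (w.snoc j a b hx hz) (w'.snoc j a b hx hz)

/-- The morphism of an elementary step. -/
def Step.hom : ∀ {x : ColimObj F} {w w' : Word F y x}, Step w w' → (w.obj ⟶ w'.obj)
  | _, _, _, .id w _ a _ => (ρ_ w.obj).inv ≫ w.obj ◁ eId V a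
  | _, _, _, .comp w _ a b c _ _ _ =>
    (α_ w.obj (a ⟶[V] b) (b ⟶[V] c)).hom ≫ w.obj ◁ eComp V a b c
  | _, _, _, .map w f a b _ _ _ _ => w.obj ◁ onHom (x := a) (y := b) (F.map f) rfl rfl
  | _, _, _, .congr s _ a b _ _ => s.hom ▷ (a ⟶[V] b)

instance Step.hom_isComonHom {x : ColimObj F} {w w' : Word F y x} (s : Step w w') :
    IsComonHom s.hom := by
  induction s with
  | id w j a hx => exact inferInstanceAs (IsComonHom ((ρ_ w.obj).inv ≫ w.obj ◁ eId V a))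
  | comp w j a b c _ _ _ =>
    exact inferInstanceAs (IsComonHom
      ((α_ w.obj (a ⟶[V] b) (b ⟶[V] c)).hom ≫ w.obj ◁ eComp V a b c))
  | map w f a b _ _ _ _ =>
    exact inferInstanceAs (IsComonHom (w.obj ◁ onHom (x := a) (y := b) (F.map f) rfl rfl))
  | congr s j a b _ _ ih => exact inferInstanceAs (IsComonHom (s.hom ▷ (a ⟶[V] b)))

end Word

namespace RightModule

variable (M : RightModule F)

/-- The extension of a morphism to a module along words. -/
def liftWord {y : ColimObj F} {X : V} (φ : X ⟶ M.obj y) :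
    ∀ {x : ColimObj F} (w : Word F y x), X ⊗ w.obj ⟶ M.obj x
  | _, .nil => (ρ_ X).hom ≫ φ
  | _, .snoc w _ a b hx hz => (α_ X w.obj (a ⟶[V] b)).inv ≫ liftWord φ w ▷ _ ≫ M.act a b hx hz

/-- The first three kinds of steps correspond to the three axioms of a right module, and the fourth
is the induction. Hence the extension along words descends to the quotient. -/
theorem step_liftWord {y : ColimObj F} {X : V} (φ : X ⟶ M.obj y) {x : ColimObj F}
    {w w' : Word F y x} (s : Word.Step w w') :
    X ◁ s.hom ≫ M.liftWord φ w' = M.liftWord φ w := by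
  induction s with
  | id w j a hx =>
    change X ◁ ((ρ_ w.obj).inv ≫ w.obj ◁ eId V a) ≫ (α_ X w.obj (a ⟶[V] a)).inv ≫
      M.liftWord φ w ▷ _ ≫ M.act a a hx hx = M.liftWord φ w
    rw [MonoidalCategory.whiskerLeft_comp, Category.assoc,
      associator_inv_naturality_right_assoc, whisker_exchange_assoc, M.act_id]
    simp
  | comp w j a b c hx hx' hz =>
    change X ◁ ((α_ w.obj (a ⟶[V] b) (b ⟶[V] c)).hom ≫ w.obj ◁ eComp V a b c) ≫
      (α_ X w.obj (a ⟶[V] c)).inv ≫ M.liftWord φ w ▷ _ ≫ M.act a c hx hz =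
      (α_ X (w.obj ⊗ (a ⟶[V] b)) (b ⟶[V] c)).inv ≫
        ((α_ X w.obj (a ⟶[V] b)).inv ≫ M.liftWord φ w ▷ _ ≫ M.act a b hx hx') ▷ _ ≫
          M.act b c hx' hz
    rw [comp_whiskerRight, comp_whiskerRight, Category.assoc, Category.assoc,
      ← M.act_comp a b c hx hx' hz, MonoidalCategory.whiskerLeft_comp, Category.assoc,
      associator_inv_naturality_right_assoc, whisker_exchange_assoc]
    simp
  | map w f a b hx hz hx' hz' =>
    change X ◁ (w.obj ◁ onHom (x := a) (y := b) (F.map f) rfl rfl) ≫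
      (α_ X w.obj _).inv ≫ M.liftWord φ w ▷ _ ≫ M.act _ _ hx' hz' =
      (α_ X w.obj _).inv ≫ M.liftWord φ w ▷ _ ≫ M.act _ _ hx hz
    rw [associator_inv_naturality_right_assoc, whisker_exchange_assoc, M.act_map]
  | congr s j a b hx hz ih =>
    change X ◁ (s.hom ▷ (a ⟶[V] b)) ≫ (α_ X _ _).inv ≫ M.liftWord φ _ ▷ _ ≫ M.act _ _ hx hz =
      (α_ X _ _).inv ≫ M.liftWord φ _ ▷ _ ≫ M.act _ _ hx hz
    rw [← ih]
    simp

end RightModule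

variable [HasColimits V]

/-- The Hom-objects of the colimit: words modulo elementary steps. -/
def ColimHom (y x : ColimObj F) : V :=
  coequalizer
    (Sigma.desc fun s : Σ (w w' : Word F y x), Word.Step w w' =>
      Sigma.ι (fun w : Word F y x => w.obj) s.1)
    (Sigma.desc fun s : Σ (w w' : Word F y x), Word.Step w w' =>
      s.2.2.hom ≫ Sigma.ι (fun w : Word F y x => w.obj) s.2.1)

/-- The canonical morphism from a word to a Hom-object of the colimit. -/
def wordι {y x : ColimObj F} (w : Word F y x) : w.obj ⟶ ColimHom y x :=
  Sigma.ι (fun w : Word F y x => w.obj) w ≫ coequalizer.π _ _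

theorem step_wordι {y x : ColimObj F} {w w' : Word F y x} (s : Word.Step w w') :
    s.hom ≫ wordι w' = wordι w := by
  have h := Sigma.ι (fun s : Σ (w w' : Word F y x), Word.Step w w' => s.1.obj) ⟨w, w', s⟩ ≫=
    coequalizer.condition
      (Sigma.desc fun s : Σ (w w' : Word F y x), Word.Step w w' =>
        Sigma.ι (fun w : Word F y x => w.obj) s.1)
      (Sigma.desc fun s : Σ (w w' : Word F y x), Word.Step w w' =>
        s.2.2.hom ≫ Sigma.ι (fun w : Word F y x => w.obj) s.2.1)
  simp only [Sigma.ι_desc_assoc, Category.assoc] at h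
  exact h.symm

theorem colimHom_ext {y x : ColimObj F} {Z : V} {f g : ColimHom y x ⟶ Z}
    (h : ∀ w : Word F y x, wordι w ≫ f = wordι w ≫ g) : f = g := by
  refine coequalizer.hom_ext (Sigma.hom_ext _ _ fun w => ?_)
  exact ((Category.assoc _ _ _).symm.trans (h w)).trans (Category.assoc _ _ _)

/-- Morphisms out of a Hom-object of the colimit are families of morphisms out of the words
compatible with elementary steps. -/
def colimHomDesc {y x : ColimObj F} {Z : V} (φ : ∀ w : Word F y x, w.obj ⟶ Z)
    (hφ : ∀ (w w' : Word F y x) (s : Word.Step w w'), s.hom ≫ φ w' = φ w) : ColimHom y x ⟶ Z :=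
  coequalizer.desc (Sigma.desc φ) (Sigma.hom_ext _ _ fun s => by
    simp only [Sigma.ι_desc_assoc, Category.assoc, Sigma.ι_desc]
    exact (hφ _ _ _).symm)

theorem wordι_desc {y x : ColimObj F} {Z : V} (φ : ∀ w : Word F y x, w.obj ⟶ Z)
    (hφ : ∀ (w w' : Word F y x) (s : Word.Step w w'), s.hom ≫ φ w' = φ w) (w : Word F y x) :
    wordι w ≫ colimHomDesc φ hφ = φ w := by
  refine (Category.assoc _ _ _).trans ((congrArg _ (coequalizer.π_desc _ _)).trans ?_)
  exact Sigma.ι_desc _ _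

/-- The Hom-objects of the colimit are comonoids. -/
instance colimHomComon (y x : ColimObj F) : ComonObj (ColimHom y x) where
  counit := colimHomDesc (fun _ => ε) fun _ _ s => IsComonHom.hom_counit s.hom
  comul := colimHomDesc (fun w => Δ ≫ (wordι w ⊗ₘ wordι w)) fun _ _ s => by
    rw [IsComonHom.hom_comul_assoc, tensorHom_comp_tensorHom, step_wordι]
  counit_comul := colimHom_ext fun w => by
    rw [reassoc_of% @wordι_desc, Category.assoc, ← tensorHom_id, tensorHom_comp_tensorHom, wordι_desc,
      Category.comp_id, ComonObj.counit_comul_hom]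
  comul_counit := colimHom_ext fun w => by
    rw [reassoc_of% @wordι_desc, Category.assoc, ← id_tensorHom, tensorHom_comp_tensorHom, wordι_desc,
      Category.comp_id, ComonObj.comul_counit_hom]
  comul_assoc := colimHom_ext fun w => by
    have h : Δ[w.obj] ≫ (wordι w ⊗ₘ (Δ ≫ (wordι w ⊗ₘ wordι w))) =
        Δ[w.obj] ≫ ((Δ ≫ (wordι w ⊗ₘ wordι w)) ⊗ₘ wordι w) ≫ (α_ _ _ _).hom := by
      have h₁ : wordι w ⊗ₘ (Δ ≫ (wordι w ⊗ₘ wordι w)) =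
          w.obj ◁ Δ ≫ (wordι w ⊗ₘ (wordι w ⊗ₘ wordι w)) := by
        rw [← id_tensorHom, tensorHom_comp_tensorHom, Category.id_comp]
      have h₂ : (Δ ≫ (wordι w ⊗ₘ wordι w)) ⊗ₘ wordι w =
          Δ ▷ w.obj ≫ ((wordι w ⊗ₘ wordι w) ⊗ₘ wordι w) := by
        rw [← tensorHom_id, tensorHom_comp_tensorHom, Category.id_comp]
      rw [h₁, h₂, ComonObj.comul_assoc_assoc, Category.assoc, associator_naturality]
    rw [reassoc_of% @wordι_desc, reassoc_of% @wordι_desc, Category.assoc, Category.assoc, ← id_tensorHom,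
      ← tensorHom_id, tensorHom_comp_tensorHom, tensorHom_comp_tensorHom_assoc, wordι_desc,
      Category.comp_id, h]

instance wordι_isComonHom {y x : ColimObj F} (w : Word F y x) : IsComonHom (wordι w) where
  hom_counit := wordι_desc (fun _ => ε) _ w
  hom_comul := wordι_desc (fun w => Δ ≫ (wordι w ⊗ₘ wordι w)) _ w

theorem colimHom_isComonHom {y x : ColimObj F} {D : V} [ComonObj D] (f : ColimHom y x ⟶ D)
    (h : ∀ w : Word F y x, IsComonHom (wordι w ≫ f)) : IsComonHom f where
  hom_counit := colimHom_ext fun w => by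
    have := h w
    rw [← Category.assoc, IsComonHom.hom_counit, IsComonHom.hom_counit]
  hom_comul := colimHom_ext fun w => by
    have := h w
    rw [← Category.assoc, IsComonHom.hom_comul, IsComonHom.hom_comul_assoc,
      tensorHom_comp_tensorHom]

/-- The canonical morphism from the empty word to the colimit. -/
def nilι (y : ColimObj F) : 𝟙_ V ⟶ ColimHom y y :=
  wordι (y := y) (x := y) .nil

/-- The canonical morphism from a word with given last letter to the colimit. -/
def snocι {y x z : ColimObj F} (w : Word F y x) {j : J} (a b : (F.obj j).carrier)
    (hx : colimObj a = x) (hz : colimObj b = z) : w.obj ⊗ (a ⟶[V] b) ⟶ ColimHom y z :=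
  wordι (w.snoc j a b hx hz)

instance nilι_isComonHom (y : ColimObj F) : IsComonHom (nilι y) :=
  wordι_isComonHom (y := y) (x := y) .nil

instance snocι_isComonHom {y x z : ColimObj F} (w : Word F y x) {j : J} (a b : (F.obj j).carrier)
    (hx : colimObj a = x) (hz : colimObj b = z) : IsComonHom (snocι w a b hx hz) :=
  wordι_isComonHom (w.snoc j a b hx hz)

theorem whiskerLeft_eId_snocι {y x : ColimObj F} (w : Word F y x) {j : J} (a : (F.obj j).carrier)
    (hx : colimObj a = x) : w.obj ◁ eId V a ≫ snocι w a a hx hx = (ρ_ _).hom ≫ wordι w := by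
  rw [← step_wordι (Word.Step.id w j a hx), ← Iso.inv_comp_eq]
  exact (Category.assoc _ _ _).symm

theorem whiskerLeft_map_snocι {y x z : ColimObj F} (w : Word F y x) {j k : J} (f : j ⟶ k)
    (a b : (F.obj j).carrier) (hx : colimObj a = x) (hz : colimObj b = z)
    (hx' : colimObj (onObj (F.map f) a) = x) (hz' : colimObj (onObj (F.map f) b) = z) :
    w.obj ◁ onHom (F.map f) rfl rfl ≫ snocι w (onObj (F.map f) a) (onObj (F.map f) b) hx' hz' =
      snocι w a b hx hz :=
  step_wordι (Word.Step.map w f a b hx hz hx' hz')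

theorem step_snocι {y x z : ColimObj F} {w w' : Word F y x} (s : Word.Step w w') {j : J}
    (a b : (F.obj j).carrier) (hx : colimObj a = x) (hz : colimObj b = z) :
    s.hom ▷ (a ⟶[V] b) ≫ snocι w' a b hx hz = snocι w a b hx hz :=
  step_wordι (Word.Step.congr s j a b hx hz)

variable [MonoidalClosed V]

theorem colimHom_whiskerLeft_ext {y x : ColimObj F} (A : V) {Z : V} {f g : A ⊗ ColimHom y x ⟶ Z}
    (h : ∀ w : Word F y x, A ◁ wordι w ≫ f = A ◁ wordι w ≫ g) : f = g :=
  jointlyEpi_whiskerLeft _ (fun _ _ => colimHom_ext) A f g h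

theorem colimHom_whiskerRight_ext {y x : ColimObj F} (A : V) {Z : V} {f g : ColimHom y x ⊗ A ⟶ Z}
    (h : ∀ w : Word F y x, wordι w ▷ A ≫ f = wordι w ▷ A ≫ g) : f = g :=
  jointlyEpi_whiskerRight _ (fun _ _ => colimHom_ext) A f g h

/-- The version of `colimHomDesc` with a parameter on the left. -/
def colimHomDescLeft {y x : ColimObj F} (A : V) {Z : V} (φ : ∀ w : Word F y x, A ⊗ w.obj ⟶ Z)
    (hφ : ∀ (w w' : Word F y x) (s : Word.Step w w'), A ◁ s.hom ≫ φ w' = φ w) :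
    A ⊗ ColimHom y x ⟶ Z :=
  MonoidalClosed.uncurry (colimHomDesc (fun w => MonoidalClosed.curry (φ w)) fun _ _ s => by
    rw [← MonoidalClosed.curry_natural_left, hφ])

theorem wordι_descLeft {y x : ColimObj F} (A : V) {Z : V} (φ : ∀ w : Word F y x, A ⊗ w.obj ⟶ Z)
    (hφ : ∀ (w w' : Word F y x) (s : Word.Step w w'), A ◁ s.hom ≫ φ w' = φ w) (w : Word F y x) :
    A ◁ wordι w ≫ colimHomDescLeft A φ hφ = φ w := by
  rw [colimHomDescLeft, ← MonoidalClosed.uncurry_natural_left, wordι_desc,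
    MonoidalClosed.uncurry_curry]

/-- The right action of a member of the diagram on the Hom-objects of the colimit. -/
def colimAct {y : ColimObj F} {j : J} (a b : (F.obj j).carrier) {x z : ColimObj F}
    (hx : colimObj a = x) (hz : colimObj b = z) : ColimHom y x ⊗ (a ⟶[V] b) ⟶ ColimHom y z :=
  -- Closedness provides an adjoint to tensoring with a parameter on the left, so the letter is
  -- first braided past the Hom-object and back on each word.
  (β_ _ _).hom ≫ colimHomDescLeft (a ⟶[V] b)
    (fun w => (β_ _ _).inv ≫ snocι w a b hx hz) fun w w' s => by
      rw [BraidedCategory.braiding_inv_naturality_right_assoc, step_snocι]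

theorem wordι_colimAct {y : ColimObj F} {j : J} (a b : (F.obj j).carrier) {x z : ColimObj F}
    (hx : colimObj a = x) (hz : colimObj b = z) (w : Word F y x) :
    wordι w ▷ (a ⟶[V] b) ≫ colimAct a b hx hz = snocι w a b hx hz := by
  rw [colimAct, BraidedCategory.braiding_naturality_left_assoc, wordι_descLeft,
    Iso.hom_inv_id_assoc]

/-- The composition step for the last two letters, written as associativity of the action; it
supplies `act_comp` of the free module. -/
theorem whiskerLeft_eComp_snocι {y x x' z : ColimObj F} (w : Word F y x) {j : J}
    (a b c : (F.obj j).carrier) (hx : colimObj a = x) (hx' : colimObj b = x')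
    (hz : colimObj c = z) :
    (α_ w.obj (a ⟶[V] b) (b ⟶[V] c)).hom ≫ w.obj ◁ eComp V a b c ≫ snocι w a c hx hz =
      snocι w a b hx hx' ▷ _ ≫ colimAct b c hx' hz :=
  ((Category.assoc _ _ _).symm.trans (step_wordι (Word.Step.comp w j a b c hx hx' hz))).trans
    (wordι_colimAct b c hx' hz (w.snoc j a b hx hx')).symm

instance colimAct_isComonHom {y : ColimObj F} {j : J} (a b : (F.obj j).carrier) {x z : ColimObj F}
    (hx : colimObj a = x) (hz : colimObj b = z) :
    IsComonHom (colimAct (y := y) a b hx hz) where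
  hom_counit := colimHom_whiskerRight_ext _ fun w => by
    rw [reassoc_of% @wordι_colimAct, IsComonHom.hom_counit, IsComonHom.hom_counit]
  hom_comul := colimHom_whiskerRight_ext _ fun w => by
    rw [reassoc_of% @wordι_colimAct, IsComonHom.hom_comul, IsComonHom.hom_comul_assoc,
      tensorHom_comp_tensorHom, wordι_colimAct]

variable (F) in
/-- The Hom-objects of the colimit with fixed domain form a right module. -/
def freeModule (y : ColimObj F) : RightModule F where
  obj := ColimHom y
  act := colimAct
  act_id a x hx := colimHom_whiskerRight_ext _ fun w => by
    rw [← whisker_exchange_assoc, wordι_colimAct, whiskerLeft_eId_snocι, rightUnitor_naturality]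
  act_comp {j} a b c x x' z hx hx' hz := by
    rw [← cancel_epi (α_ _ _ _).inv, Iso.inv_hom_id_assoc]
    refine colimHom_whiskerRight_ext _ fun w => ?_
    rw [← whisker_exchange_assoc, wordι_colimAct, associator_inv_naturality_left_assoc,
      ← comp_whiskerRight_assoc, wordι_colimAct, ← cancel_epi (α_ _ _ _).hom,
      whiskerLeft_eComp_snocι w a b c hx hx' hz, Iso.hom_inv_id_assoc]
  act_map f a b x z hx hz hx' hz' := colimHom_whiskerRight_ext _ fun w => by
    rw [← whisker_exchange_assoc, wordι_colimAct, wordι_colimAct, whiskerLeft_map_snocι]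

namespace RightModule

variable (M : RightModule F)

/-- The module morphism out of a free module extending a given morphism. -/
def lift {y : ColimObj F} {X : V} (φ : X ⟶ M.obj y) (x : ColimObj F) :
    X ⊗ ColimHom y x ⟶ M.obj x :=
  colimHomDescLeft X (M.liftWord φ) fun _ _ s => M.step_liftWord φ s

theorem nilι_lift {y : ColimObj F} {X : V} (φ : X ⟶ M.obj y) :
    X ◁ nilι y ≫ M.lift φ y = (ρ_ X).hom ≫ φ :=
  wordι_descLeft X (M.liftWord φ) _ .nil

theorem wordι_lift {y : ColimObj F} {X : V} (φ : X ⟶ M.obj y) {x : ColimObj F} (w : Word F y x) :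
    X ◁ wordι w ≫ M.lift φ x = M.liftWord φ w :=
  wordι_descLeft X (M.liftWord φ) _ w

/-- Equivariance of the extension. It holds word by word since `liftWord` is defined by recursion on
the last letter. -/
theorem colimAct_lift {y : ColimObj F} {X : V} (φ : X ⟶ M.obj y) {j : J}
    (a b : (F.obj j).carrier) {x z : ColimObj F} (hx : colimObj a = x) (hz : colimObj b = z) :
    X ◁ colimAct a b hx hz ≫ M.lift φ z =
      (α_ _ _ _).inv ≫ M.lift φ x ▷ _ ≫ M.act a b hx hz := by
  rw [← cancel_epi (α_ _ _ _).hom, Iso.hom_inv_id_assoc]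
  refine jointlyEpi_whiskerRight _ (fun _ _ => colimHom_whiskerLeft_ext X) _ _ _ fun w => ?_
  rw [associator_naturality_middle_assoc, ← MonoidalCategory.whiskerLeft_comp_assoc,
    wordι_colimAct, ← comp_whiskerRight_assoc, wordι_lift]
  exact (congrArg _ (M.wordι_lift φ (w.snoc j a b hx hz))).trans (Iso.hom_inv_id_assoc _ _)

end RightModule

/-- Two families of morphisms out of the Hom-objects of the colimit are equal if they are
equivariant and agree on the unit. -/
theorem equivariant_ext {y : ColimObj F} {X : V} {Z : ColimObj F → V}
    (act : ∀ {j : J} (a b : (F.obj j).carrier) {x z : ColimObj F} (_ : colimObj a = x)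
      (_ : colimObj b = z), Z x ⊗ (a ⟶[V] b) ⟶ Z z)
    (f g : ∀ x, X ⊗ ColimHom y x ⟶ Z x)
    (hf : ∀ {j : J} (a b : (F.obj j).carrier) {x z : ColimObj F} (hx : colimObj a = x)
      (hz : colimObj b = z), X ◁ colimAct a b hx hz ≫ f z =
        (α_ _ _ _).inv ≫ f x ▷ _ ≫ act a b hx hz)
    (hg : ∀ {j : J} (a b : (F.obj j).carrier) {x z : ColimObj F} (hx : colimObj a = x)
      (hz : colimObj b = z), X ◁ colimAct a b hx hz ≫ g z =
        (α_ _ _ _).inv ≫ g x ▷ _ ≫ act a b hx hz)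
    (h : X ◁ nilι y ≫ f y = X ◁ nilι y ≫ g y) (x : ColimObj F) : f x = g x := by
  refine colimHom_whiskerLeft_ext X fun w => ?_
  -- Every word is obtained from the empty one by successive actions of letters, so equivariance
  -- propagates equality from the generator.
  induction w with
  | nil => exact h
  | snoc w j a b hx hz ih =>
    change X ◁ snocι w a b hx hz ≫ _ = X ◁ snocι w a b hx hz ≫ _
    rw [← wordι_colimAct, MonoidalCategory.whiskerLeft_comp, Category.assoc, Category.assoc, hf, hg,
      associator_inv_naturality_middle_assoc, associator_inv_naturality_middle_assoc,
      ← comp_whiskerRight_assoc, ← comp_whiskerRight_assoc, ih]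

end SemiHopfCat

end

/-! ### The colimit category and its universal property -/

noncomputable section

section Enriched

variable {V : Type u} [Category.{v} V] [MonoidalCategory V] {B : Type*} [EnrichedCategory V B]

theorem tensorHom_eId_eComp {X : V} {x y : B} (f : X ⟶ (x ⟶[V] y)) :
    (f ⊗ₘ eId V y) ≫ eComp V x y y = (ρ_ X).hom ≫ f := by
  rw [MonoidalCategory.tensorHom_def, Category.assoc, ← Iso.inv_comp_eq,
    ← rightUnitor_inv_naturality_assoc, e_comp_id, Category.comp_id]

theorem eId_tensorHom_eComp {X : V} {x y : B} (f : X ⟶ (x ⟶[V] y)) :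
    (eId V x ⊗ₘ f) ≫ eComp V x x y = (λ_ X).hom ≫ f := by
  rw [MonoidalCategory.tensorHom_def', Category.assoc, ← Iso.inv_comp_eq,
    ← leftUnitor_inv_naturality_assoc, e_id_comp, Category.comp_id]

theorem tensorHom_eComp_assoc {X Y Z : V} {x y z t : B} (f : X ⟶ (x ⟶[V] y))
    (g : Y ⟶ (y ⟶[V] z)) (h : Z ⟶ (z ⟶[V] t)) :
    (f ⊗ₘ ((g ⊗ₘ h) ≫ eComp V y z t)) ≫ eComp V x y t =
      (α_ _ _ _).inv ≫ (((f ⊗ₘ g) ≫ eComp V x y z) ⊗ₘ h) ≫ eComp V x z t := by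
  have h₁ : f ⊗ₘ ((g ⊗ₘ h) ≫ eComp V y z t) = (f ⊗ₘ (g ⊗ₘ h)) ≫ _ ◁ eComp V y z t := by
    rw [← id_tensorHom, tensorHom_comp_tensorHom, Category.comp_id]
  have h₂ : ((f ⊗ₘ g) ≫ eComp V x y z) ⊗ₘ h = ((f ⊗ₘ g) ⊗ₘ h) ≫ eComp V x y z ▷ _ := by
    rw [← tensorHom_id, tensorHom_comp_tensorHom, Category.comp_id]
  rw [h₁, h₂, Category.assoc, ← e_assoc, Category.assoc, associator_inv_naturality_assoc]

end Enriched

namespace SemiHopfCat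

variable {V : Type u} [Category.{v} V] [MonoidalCategory V] [BraidedCategory V]

attribute [local instance] ComonObj.instTensorUnit

variable {J : Type v} [SmallCategory J] {F : J ⥤ SemiHopfCat V}

section Desc

variable (s : Cocone F)

/-- The action on objects of the functor induced by a cocone. -/
def descObj : ColimObj F → s.pt.carrier :=
  Quot.lift (fun p => onObj (s.ι.app p.1) p.2) (by
    rintro p q ⟨f, hf⟩
    rw [← hf]
    exact (congrArg (fun G => onObj G p.2) (s.w f)).symm)

theorem onObj_eq_descObj {j : J} (a : (F.obj j).carrier) {x : ColimObj F} (hx : colimObj a = x) :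
    onObj (s.ι.app j) a = descObj s x := by
  subst hx; rfl

/-- The right module of Hom-objects with fixed domain of the apex of a cocone. -/
def coconeModule (y : s.pt.carrier) : RightModule F where
  obj x := y ⟶[V] descObj s x
  act {j} a b {x z} hx hz :=
    _ ◁ onHom (s.ι.app j) (onObj_eq_descObj s a hx) (onObj_eq_descObj s b hz) ≫ eComp V _ _ _
  act_id a x hx := by
    rw [← MonoidalCategory.whiskerLeft_comp_assoc, onHom_id, ← Iso.inv_comp_eq_id, e_comp_id]
  act_comp a b c x x' z hx hx' hz := by
    rw [← MonoidalCategory.whiskerLeft_comp_assoc,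
      onHom_comp _ _ (onObj_eq_descObj s b hx'), MonoidalCategory.whiskerLeft_comp, Category.assoc,
      ← e_assoc]
    simp [MonoidalCategory.tensorHom_def, ← whisker_exchange_assoc]
  act_map f a b x z hx hz hx' hz' := by
    rw [← MonoidalCategory.whiskerLeft_comp_assoc,
      onHom_onHom _ _ _ _ _ _ ((congrArg (fun G => onObj G a) (s.w f)).trans
        (onObj_eq_descObj s a hx)) ((congrArg (fun G => onObj G b) (s.w f)).trans
        (onObj_eq_descObj s b hz)), onHom_congr (s.w f)]

end Desc

variable [HasColimits V] [MonoidalClosed V]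

/-- The composition of the colimit. -/
def colimComp (x y z : ColimObj F) : ColimHom x y ⊗ ColimHom y z ⟶ ColimHom x z :=
  (freeModule F x).lift (y := y) (𝟙 (ColimHom x y)) z

theorem nilι_colimComp (x y : ColimObj F) :
    ColimHom x y ◁ nilι y ≫ colimComp x y y = (ρ_ _).hom :=
  ((freeModule F x).nilι_lift _).trans (Category.comp_id _)

theorem colimAct_colimComp (x y : ColimObj F) {j : J} (a b : (F.obj j).carrier) {z z' : ColimObj F}
    (hz : colimObj a = z) (hz' : colimObj b = z') :
    ColimHom x y ◁ colimAct a b hz hz' ≫ colimComp x y z' =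
      (α_ _ _ _).inv ≫ colimComp x y z ▷ _ ≫ colimAct a b hz hz' :=
  (freeModule F x).colimAct_lift _ a b hz hz'

theorem colimId_colimComp (x y : ColimObj F) :
    nilι x ▷ ColimHom x y ≫ colimComp x x y = (λ_ _).hom := by
  refine equivariant_ext (X := 𝟙_ V) (Z := ColimHom x) colimAct
    (fun y => nilι x ▷ ColimHom x y ≫ colimComp x x y) (fun y => (λ_ _).hom) ?_ ?_ ?_ y
  · intro j a b z z' hz hz'
    rw [whisker_exchange_assoc, colimAct_colimComp]
    simp
  · intro j a b z z' hz hz'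
    simp
  · rw [whisker_exchange_assoc, nilι_colimComp, rightUnitor_naturality, leftUnitor_naturality,
      unitors_equal]

/-- As functions of the last object, both composites are equivariant for right multiplication by
letters, and they agree on the unit. The unit law above is proved in the same way. -/
theorem colimComp_assoc (w x y z : ColimObj F) :
    (α_ _ _ _).inv ≫ colimComp w x y ▷ ColimHom y z ≫ colimComp w y z =
      ColimHom w x ◁ colimComp x y z ≫ colimComp w x z := by
  rw [Iso.inv_comp_eq]
  refine equivariant_ext (Z := ColimHom w) colimAct
    (fun z => colimComp w x y ▷ ColimHom y z ≫ colimComp w y z)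
    (fun z => (α_ _ _ _).hom ≫ ColimHom w x ◁ colimComp x y z ≫ colimComp w x z) ?_ ?_ ?_ z
  · intro j a b z z' hz hz'
    rw [whisker_exchange_assoc, colimAct_colimComp]
    simp
  · intro j a b z z' hz hz'
    rw [associator_naturality_right_assoc, ← MonoidalCategory.whiskerLeft_comp_assoc,
      colimAct_colimComp]
    simp only [MonoidalCategory.whiskerLeft_comp, Category.assoc, colimAct_colimComp]
    simp
  · rw [whisker_exchange_assoc, nilι_colimComp, associator_naturality_right_assoc,
      ← MonoidalCategory.whiskerLeft_comp_assoc, nilι_colimComp]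
    simp

/-- The composition of the colimit on words. -/
def colimCompWord (x : ColimObj F) {y z : ColimObj F} (w : Word F y z) :
    ColimHom x y ⊗ w.obj ⟶ ColimHom x z :=
  (freeModule F x).liftWord (y := y) (𝟙 (ColimHom x y)) w

theorem wordι_colimComp (x : ColimObj F) {y z : ColimObj F} (w : Word F y z) :
    ColimHom x y ◁ wordι w ≫ colimComp x y z = colimCompWord x w :=
  (freeModule F x).wordι_lift _ w

instance colimCompWord_isComonHom (x : ColimObj F) {y z : ColimObj F} (w : Word F y z) :
    IsComonHom (colimCompWord x w) := by
  induction w with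
  | nil => exact inferInstanceAs (IsComonHom ((ρ_ (ColimHom x y)).hom ≫ 𝟙 (ColimHom x y)))
  | snoc w j a b hx hz ih =>
    exact inferInstanceAs (IsComonHom ((α_ (ColimHom x y) w.obj (a ⟶[V] b)).inv ≫
      colimCompWord x w ▷ _ ≫ colimAct a b hx hz))

instance colimComp_isComonHom (x y z : ColimObj F) : IsComonHom (colimComp x y z) where
  hom_counit := colimHom_whiskerLeft_ext _ fun w => by
    rw [reassoc_of% @wordι_colimComp, IsComonHom.hom_counit, IsComonHom.hom_counit]
  hom_comul := colimHom_whiskerLeft_ext _ fun w => by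
    rw [reassoc_of% @wordι_colimComp, IsComonHom.hom_comul, IsComonHom.hom_comul_assoc,
      tensorHom_comp_tensorHom, wordι_colimComp]

variable (F) in
/-- The colimit of a diagram of semi-Hopf categories. -/
def colimCat : SemiHopfCat V where
  carrier := ColimObj F
  enriched :=
    { Hom := ColimHom
      id := nilι
      comp := colimComp
      id_comp x y := by rw [colimId_colimComp, Iso.inv_hom_id]
      comp_id x y := by rw [nilι_colimComp, Iso.inv_hom_id]
      assoc := colimComp_assoc }
  comon := colimHomComon
  comp_comul x y z := by
    have h := IsComonHom.hom_comul (colimComp x y z)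
    rw [Comon.tensorObj_comul, Category.assoc] at h
    exact h
  comp_counit x y z := IsComonHom.hom_counit (colimComp x y z)
  id_comul x := IsComonHom.hom_comul (nilι x)
  id_counit x := IsComonHom.hom_counit (nilι x)

/-- The Hom-objects of a member of the diagram, mapped to the colimit. -/
def letter {j : J} (a b : (F.obj j).carrier) {x z : ColimObj F} (hx : colimObj a = x)
    (hz : colimObj b = z) : (a ⟶[V] b) ⟶ ColimHom x z :=
  (λ_ _).inv ≫ nilι x ▷ _ ≫ colimAct a b hx hz

instance letter_isComonHom {j : J} (a b : (F.obj j).carrier) {x z : ColimObj F}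
    (hx : colimObj a = x) (hz : colimObj b = z) : IsComonHom (letter a b hx hz) :=
  inferInstanceAs (IsComonHom ((λ_ _).inv ≫ nilι x ▷ _ ≫ colimAct a b hx hz))

/-- Identifies the module action with composition by the image of a letter. From here on, the module
axioms become functoriality of the letters. -/
theorem letter_colimComp (y : ColimObj F) {j : J} (a b : (F.obj j).carrier) {x z : ColimObj F}
    (hx : colimObj a = x) (hz : colimObj b = z) :
    ColimHom y x ◁ letter a b hx hz ≫ colimComp y x z = colimAct a b hx hz := by
  rw [letter, MonoidalCategory.whiskerLeft_comp_assoc, MonoidalCategory.whiskerLeft_comp_assoc,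
    colimAct_colimComp, associator_inv_naturality_middle_assoc, ← comp_whiskerRight_assoc,
    nilι_colimComp]
  simp

theorem eId_letter {j : J} (a : (F.obj j).carrier) {x : ColimObj F} (hx : colimObj a = x) :
    eId V a ≫ letter a a hx hx = nilι x := by
  have h := (freeModule F x).act_id a hx
  change ColimHom x x ◁ eId V a ≫ colimAct a a hx hx = (ρ_ _).hom at h
  rw [letter, leftUnitor_inv_naturality_assoc, whisker_exchange_assoc, h, rightUnitor_naturality,
    ← unitors_equal, Iso.inv_hom_id_assoc]

theorem eComp_letter {j : J} (a b c : (F.obj j).carrier) {x y z : ColimObj F}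
    (hx : colimObj a = x) (hy : colimObj b = y) (hz : colimObj c = z) :
    eComp V a b c ≫ letter a c hx hz =
      (letter a b hx hy ⊗ₘ letter b c hy hz) ≫ colimComp x y z := by
  have h := (freeModule F x).act_comp a b c hx hy hz
  change (α_ (ColimHom x x) (a ⟶[V] b) (b ⟶[V] c)).hom ≫ ColimHom x x ◁ eComp V a b c ≫
    colimAct a c hx hz = colimAct a b hx hy ▷ _ ≫ colimAct b c hy hz at h
  rw [MonoidalCategory.tensorHom_def, Category.assoc, letter_colimComp, letter, letter,
    comp_whiskerRight, comp_whiskerRight, Category.assoc, Category.assoc, ← h,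
    leftUnitor_inv_naturality_assoc, whisker_exchange_assoc]
  simp

theorem onHom_letter {j k : J} (f : j ⟶ k) (a b : (F.obj j).carrier) {x z : ColimObj F}
    (hx : colimObj a = x) (hz : colimObj b = z) (hx' : colimObj (onObj (F.map f) a) = x)
    (hz' : colimObj (onObj (F.map f) b) = z) :
    onHom (F.map f) rfl rfl ≫ letter (onObj (F.map f) a) (onObj (F.map f) b) hx' hz' =
      letter a b hx hz := by
  have h := (freeModule F x).act_map f a b hx hz hx' hz'
  change ColimHom x x ◁ onHom (F.map f) rfl rfl ≫ colimAct (onObj (F.map f) a)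
    (onObj (F.map f) b) hx' hz' = colimAct a b hx hz at h
  rw [letter, leftUnitor_inv_naturality_assoc, whisker_exchange_assoc, h, letter]

/-- The version of `equivariant_ext` without parameter. -/
theorem equivariant_ext_unit {y : ColimObj F} {Z : ColimObj F → V}
    (act : ∀ {j : J} (a b : (F.obj j).carrier) {x z : ColimObj F} (_ : colimObj a = x)
      (_ : colimObj b = z), Z x ⊗ (a ⟶[V] b) ⟶ Z z)
    (f g : ∀ x, ColimHom y x ⟶ Z x)
    (hf : ∀ {j : J} (a b : (F.obj j).carrier) {x z : ColimObj F} (hx : colimObj a = x)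
      (hz : colimObj b = z), colimAct a b hx hz ≫ f z = f x ▷ _ ≫ act a b hx hz)
    (hg : ∀ {j : J} (a b : (F.obj j).carrier) {x z : ColimObj F} (hx : colimObj a = x)
      (hz : colimObj b = z), colimAct a b hx hz ≫ g z = g x ▷ _ ≫ act a b hx hz)
    (h : nilι y ≫ f y = nilι y ≫ g y) (x : ColimObj F) : f x = g x := by
  rw [← cancel_epi (λ_ _).hom]
  refine equivariant_ext act (fun x => (λ_ _).hom ≫ f x) (fun x => (λ_ _).hom ≫ g x) ?_ ?_ ?_ x
  · intro j a b x z hx hz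
    simp [hf]
  · intro j a b x z hx hz
    simp [hg]
  · simp [h]

/-- The components of the colimit cocone. -/
def colimι (j : J) : F.obj j ⟶ colimCat F :=
  show Hom (F.obj j) (colimCat F) from
    { toFunctor :=
        { obj := colimObj
          map := fun a b => letter a b rfl rfl
          map_id := fun a => eId_letter a rfl
          map_comp := fun a b c => eComp_letter a b c rfl rfl rfl }
      isComonHom := fun a b => letter_isComonHom a b rfl rfl }

theorem onHom_colimι {j : J} (a b : (F.obj j).carrier) {x z : (colimCat F).carrier}
    (hx : onObj (colimι j) a = x) (hz : onObj (colimι j) b = z) :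
    onHom (colimι j) hx hz = letter a b hx hz := by
  subst hx hz
  exact onHom_rfl _ _ _

variable (F) in
/-- The colimit cocone. -/
def colimCocone : Cocone F where
  pt := colimCat F
  ι :=
    { app := colimι
      naturality := fun j k f => by
        refine (hom_ext (A := F.obj j) (B := colimCat F) (F := F.map f ≫ colimι k)
          (G := colimι j) (fun a => colimObj_map f a) fun a b => ?_).trans (Category.comp_id _).symm
        have h := onHom_onHom (F.map f) (colimι k) (x := a) (y := b)
          (x'' := onObj (colimι j) a) (y'' := onObj (colimι j) b) rfl rfl (colimObj_map f a)
          (colimObj_map f b) (colimObj_map f a) (colimObj_map f b)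
        refine h.symm.trans ((congrArg _ (onHom_colimι _ _ _ _)).trans ?_)
        exact (onHom_letter f a b rfl rfl _ _).trans (onHom_colimι a b rfl rfl).symm }

namespace RightModule

variable (M : RightModule F) {y : ColimObj F} (φ : 𝟙_ V ⟶ M.obj y)

/-- The module morphism out of a free module extending a generalized element. -/
def liftUnit (x : ColimObj F) : ColimHom y x ⟶ M.obj x :=
  (λ_ _).inv ≫ M.lift φ x

theorem nilι_liftUnit : nilι y ≫ M.liftUnit φ y = φ := by
  rw [liftUnit, leftUnitor_inv_naturality_assoc, nilι_lift, ← unitors_equal,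
    Iso.inv_hom_id_assoc]

theorem colimAct_liftUnit {j : J} (a b : (F.obj j).carrier) {x z : ColimObj F}
    (hx : colimObj a = x) (hz : colimObj b = z) :
    colimAct a b hx hz ≫ M.liftUnit φ z = M.liftUnit φ x ▷ _ ≫ M.act a b hx hz := by
  rw [liftUnit, leftUnitor_inv_naturality_assoc, colimAct_lift, liftUnit]
  simp

end RightModule

section Desc

variable (s : Cocone F)

/-- The components of the functor induced by a cocone. -/
def descHom (y x : ColimObj F) : ColimHom y x ⟶ (descObj s y ⟶[V] descObj s x) :=
  (coconeModule s (descObj s y)).liftUnit (y := y) (eId V (descObj s y)) x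

theorem nilι_descHom (y : ColimObj F) : nilι y ≫ descHom s y y = eId V (descObj s y) :=
  (coconeModule s (descObj s y)).nilι_liftUnit _

theorem colimAct_descHom (y : ColimObj F) {j : J} (a b : (F.obj j).carrier) {x z : ColimObj F}
    (hx : colimObj a = x) (hz : colimObj b = z) :
    colimAct a b hx hz ≫ descHom s y z =
      (descHom s y x ⊗ₘ
        onHom (s.ι.app j) (onObj_eq_descObj s a hx) (onObj_eq_descObj s b hz)) ≫
          eComp V _ _ _ := by
  rw [MonoidalCategory.tensorHom_def, Category.assoc]
  exact (coconeModule s (descObj s y)).colimAct_liftUnit _ a b hx hz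

/-- Both sides are equivariant morphisms into the module of Hom-objects of the cocone's apex out of
the image of `x`; on the generator they reduce to the unit law. -/
theorem colimComp_descHom (x y z : ColimObj F) :
    colimComp x y z ≫ descHom s x z = (descHom s x y ⊗ₘ descHom s y z) ≫ eComp V _ _ _ := by
  refine equivariant_ext (Z := fun z => descObj s x ⟶[V] descObj s z)
    (coconeModule s (descObj s x)).act (fun z => colimComp x y z ≫ descHom s x z)
    (fun z => (descHom s x y ⊗ₘ descHom s y z) ≫ eComp V _ _ _) ?_ ?_ ?_ z
  · intro j a b z z' hz hz'
    simp [reassoc_of% @colimAct_colimComp, colimAct_descHom, coconeModule, MonoidalCategory.tensorHom_def]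
  · intro j a b z z' hz hz'
    rw [← id_tensorHom, tensorHom_comp_tensorHom_assoc, Category.id_comp, colimAct_descHom,
      tensorHom_eComp_assoc, MonoidalCategory.tensorHom_def, Category.assoc]
    rfl
  · rw [← id_tensorHom, tensorHom_comp_tensorHom_assoc, Category.id_comp, nilι_descHom,
      tensorHom_eId_eComp, id_tensorHom, reassoc_of% @nilι_colimComp]

instance descHom_isComonHom (y x : ColimObj F) : IsComonHom (descHom s y x) := by
  refine colimHom_isComonHom _ fun w => ?_
  induction w with
  | nil =>
    have h : IsComonHom (nilι y ≫ descHom s y y) := by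
      rw [nilι_descHom]; infer_instance
    exact h
  | snoc w j a b hx hz ih =>
    rename_i x z
    have h : snocι w a b hx hz ≫ descHom s y z =
        ((wordι w ≫ descHom s y x) ⊗ₘ
          onHom (s.ι.app j) (onObj_eq_descObj s a hx) (onObj_eq_descObj s b hz)) ≫
            eComp V _ _ _ := by
      rw [← wordι_colimAct, Category.assoc, colimAct_descHom, ← tensorHom_id,
        tensorHom_comp_tensorHom_assoc, Category.id_comp]
    have h' : IsComonHom (snocι w a b hx hz ≫ descHom s y z) := by
      rw [h]; infer_instance
    exact h'

theorem letter_descHom {j : J} (a b : (F.obj j).carrier) {x z : ColimObj F}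
    (hx : colimObj a = x) (hz : colimObj b = z) :
    letter a b hx hz ≫ descHom s x z =
      onHom (s.ι.app j) (onObj_eq_descObj s a hx) (onObj_eq_descObj s b hz) := by
  rw [letter, Category.assoc, Category.assoc, colimAct_descHom, ← tensorHom_id,
    tensorHom_comp_tensorHom_assoc, Category.id_comp, nilι_descHom, eId_tensorHom_eComp,
    Iso.inv_hom_id_assoc]

/-- The functor induced by a cocone. -/
def colimDesc : colimCat F ⟶ s.pt :=
  show Hom (colimCat F) s.pt from
    { toFunctor :=
        { obj := descObj s
          map := descHom s
          map_id := nilι_descHom s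
          map_comp := colimComp_descHom s }
      isComonHom := descHom_isComonHom s }

theorem onObj_of_fac (m : colimCat F ⟶ s.pt) (hm : ∀ j, colimι j ≫ m = s.ι.app j)
    (x : ColimObj F) : onObj m x = descObj s x := by
  obtain ⟨j, a⟩ := x
  exact congrArg (fun G => onObj G a) (hm j)

/-- A multiplicative family with the prescribed values on letters is a module morphism. This brings
uniqueness of the comparison functor under `equivariant_ext_unit`. -/
theorem colimAct_of_letter {y x z : ColimObj F} {j : J} (a b : (F.obj j).carrier)
    (hx : colimObj a = x) (hz : colimObj b = z)
    (p : ColimHom y x ⟶ (descObj s y ⟶[V] descObj s x))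
    (q : ColimHom x z ⟶ (descObj s x ⟶[V] descObj s z))
    (r : ColimHom y z ⟶ (descObj s y ⟶[V] descObj s z))
    (h₁ : colimComp y x z ≫ r = (p ⊗ₘ q) ≫ eComp V _ _ _)
    (h₂ : letter a b hx hz ≫ q =
      onHom (s.ι.app j) (onObj_eq_descObj s a hx) (onObj_eq_descObj s b hz)) :
    colimAct a b hx hz ≫ r = p ▷ _ ≫ (coconeModule s (descObj s y)).act a b hx hz := by
  rw [← letter_colimComp, Category.assoc, h₁, ← id_tensorHom, tensorHom_comp_tensorHom_assoc,
    Category.id_comp, h₂, MonoidalCategory.tensorHom_def, Category.assoc]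
  rfl

/-- Morphisms from the Hom-objects of the colimit to a cocone are unique. -/
theorem onHom_of_fac (m : colimCat F ⟶ s.pt) (hm : ∀ j, colimι j ≫ m = s.ι.app j)
    (y x : ColimObj F) :
    onHom m (onObj_of_fac s m hm y) (onObj_of_fac s m hm x) = descHom s y x := by
  refine equivariant_ext_unit (Z := fun x => descObj s y ⟶[V] descObj s x)
    (coconeModule s (descObj s y)).act
    (fun x => onHom m (onObj_of_fac s m hm y) (onObj_of_fac s m hm x))
    (fun x => descHom s y x) ?_ ?_ ?_ x
  · intro j a b x z hx hz
    have h₁ := onHom_comp m (onObj_of_fac s m hm y) (onObj_of_fac s m hm x) (onObj_of_fac s m hm z)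
    have h₂ : letter a b hx hz ≫ onHom m (onObj_of_fac s m hm x) (onObj_of_fac s m hm z) =
        onHom (s.ι.app j) (onObj_eq_descObj s a hx) (onObj_eq_descObj s b hz) := by
      refine (congrArg (· ≫ _) (onHom_colimι a b hx hz).symm).trans ?_
      refine (onHom_onHom _ _ _ _ _ _ ?_ ?_).trans (onHom_congr (hm j) _ _ _ _)
      · exact (congrArg (fun G => onObj G a) (hm j)).trans (onObj_eq_descObj s a hx)
      · exact (congrArg (fun G => onObj G b) (hm j)).trans (onObj_eq_descObj s b hz)
    change colimComp y x z ≫ _ = _ at h₁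
    exact colimAct_of_letter s a b hx hz _ _ _ h₁ h₂
  · intro j a b x z hx hz
    rw [colimAct_descHom, MonoidalCategory.tensorHom_def, Category.assoc]
    rfl
  · exact (onHom_id m _ _).trans (nilι_descHom s y).symm

end Desc

variable (F) in
/-- The colimit cocone is a colimit. -/
def colimCoconeIsColimit : IsColimit (colimCocone F) where
  desc := colimDesc
  fac s j := hom_ext (A := F.obj j) (F := colimι j ≫ colimDesc s) (G := s.ι.app j)
    (fun a => rfl) fun a b => by
      refine (onHom_onHom (colimι j) (colimDesc s) rfl rfl rfl rfl rfl rfl).symm.trans ?_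
      refine (congrArg (· ≫ _) (onHom_colimι a b rfl rfl)).trans ?_
      refine (congrArg (_ ≫ ·) (onHom_rfl (colimDesc s) (colimObj a) (colimObj b))).trans ?_
      exact letter_descHom s a b rfl rfl
  uniq s m hm := hom_ext (A := colimCat F) (F := m) (G := colimDesc s) (onObj_of_fac s m hm)
    fun y x => (onHom_of_fac s m hm y x).trans (onHom_rfl (colimDesc s) y x).symm

theorem hasColimits : HasColimits (SemiHopfCat V) where
  has_colimits_of_shape _ _ := ⟨fun F => ⟨⟨⟨colimCocone F, colimCoconeIsColimit F⟩⟩⟩⟩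

end SemiHopfCat

end

/-! ### The antipode of a colimit of Hopf categories -/

noncomputable section

/-- The hexagon identities behind `(x · a) · b = x · (ab)` for an action that moves letters to the
left and reverses them. -/
theorem associator_braiding_braiding {V : Type u} [Category.{v} V] [MonoidalCategory V]
    [BraidedCategory V] (X : V) {A B A' B' : V} (g : A ⟶ A') (h : B ⟶ B') :
    (α_ X A B).hom ≫ (β_ X (A ⊗ B)).hom ≫ ((β_ A B).hom ≫ (h ⊗ₘ g)) ▷ X =
      (β_ X A).hom ▷ B ≫ (β_ (A ⊗ X) B).hom ≫ (h ⊗ₘ (g ▷ X)) ≫ (α_ _ _ _).inv := by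
  rw [BraidedCategory.braiding_tensor_right_hom, BraidedCategory.braiding_tensor_left_hom]
  simp [MonoidalCategory.tensorHom_def]

namespace SemiHopfCat

variable {V : Type u} [Category.{v} V] [MonoidalCategory V] [BraidedCategory V]

attribute [local instance] ComonObj.instTensorUnit

variable {J : Type v} [SmallCategory J] {F : J ⥤ SemiHopfCat V} [HasColimits V] [MonoidalClosed V]

section Antipode

variable {S : ∀ j, ∀ a b : (F.obj j).carrier, (a ⟶[V] b) ⟶ (b ⟶[V] a)}
  (hS : ∀ j, (F.obj j).IsAntipode (S j))

/-- The opposite action of the members of the diagram, twisted by antipodes. -/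
def antipodeModule (y : ColimObj F) : RightModule F where
  obj x := ColimHom x y
  act {j} a b {x z} hx hz :=
    (β_ _ _).hom ≫ (S j a b ≫ letter b a hz hx) ▷ _ ≫ colimComp z x y
  act_id {j} a x hx := by
    rw [BraidedCategory.braiding_naturality_right_assoc, ← comp_whiskerRight_assoc,
      ← Category.assoc (eId V a), (hS j).eId_comp, eId_letter, colimId_colimComp,
      braiding_leftUnitor]
  act_comp {j} a b c x x' z hx hx' hz := by
    -- With `x · a = S(a) x`, the axiom reads `S(ab) x = S(b) (S(a) x)`: the antipode reverses the
    -- product.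
    have h₁ : eComp V a b c ≫ S j a c ≫ letter c a hz hx =
        ((β_ _ _).hom ≫ ((S j b c ≫ letter c b hz hx') ⊗ₘ (S j a b ≫ letter b a hx' hx))) ≫
          colimComp z x' x := by
      rw [reassoc_of% (hS j).eComp_comp, eComp_letter c b a hz hx' hx,
        tensorHom_comp_tensorHom_assoc, Category.assoc]
    rw [BraidedCategory.braiding_naturality_right_assoc, ← comp_whiskerRight_assoc, h₁]
    generalize S j a b ≫ letter b a hx' hx = p
    generalize S j b c ≫ letter c b hz hx' = q
    have h₂ := associator_braiding_braiding (ColimHom x y) p q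
    rw [comp_whiskerRight, Category.assoc, reassoc_of% h₂, colimComp_assoc, comp_whiskerRight,
      Category.assoc, comp_whiskerRight, Category.assoc,
      BraidedCategory.braiding_naturality_left_assoc (colimComp x' x y),
      BraidedCategory.braiding_naturality_left_assoc (p ▷ _), MonoidalCategory.tensorHom_def,
      Category.assoc, whisker_exchange_assoc, whisker_exchange_assoc]
  act_map {j k} f a b x z hx hz hx' hz' := by
    rw [BraidedCategory.braiding_naturality_right_assoc, ← comp_whiskerRight_assoc,
      ← Category.assoc (onHom _ _ _), ← (hS j).comp_onHom (hS k), Category.assoc, onHom_letter]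

/-- An object of the colimit, as an object of the colimit category. -/
def colimCatObj (x : ColimObj F) : (colimCat F).carrier := x

/-- The canonical morphism from a word to a Hom-object of the colimit category. -/
def wordHom {y x : ColimObj F} (w : Word F y x) : w.obj ⟶ (colimCatObj y ⟶[V] colimCatObj x) :=
  wordι w

instance {y x : ColimObj F} (w : Word F y x) : IsComonHom (wordHom w) :=
  wordι_isComonHom w

/-- The canonical morphism from a letter to a Hom-object of the colimit category. -/
def letterHom {j : J} (a b : (F.obj j).carrier) {x z : ColimObj F}
    (hx : colimObj a = x) (hz : colimObj b = z) : (a ⟶[V] b) ⟶ (colimCatObj x ⟶[V] colimCatObj z) :=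
  letter a b hx hz

/-- The canonical morphism from a word with given last letter to a Hom-object of the colimit
category. -/
def snocHom {y x z : ColimObj F} (w : Word F y x) {j : J} (a b : (F.obj j).carrier)
    (hx : colimObj a = x) (hz : colimObj b = z) :
    w.obj ⊗ (a ⟶[V] b) ⟶ (colimCatObj y ⟶[V] colimCatObj z) :=
  snocι w a b hx hz

/-- The antipode of a colimit of Hopf categories. -/
def colimAntipode (y x : ColimObj F) :
    (colimCatObj y ⟶[V] colimCatObj x) ⟶ (colimCatObj x ⟶[V] colimCatObj y) :=
  (antipodeModule hS y).liftUnit (y := y) (nilι y) x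

theorem eId_letterHom {j : J} (a : (F.obj j).carrier) {x : ColimObj F}
    (hx : colimObj a = x) : eId V a ≫ letterHom a a hx hx = eId V (colimCatObj x) :=
  eId_letter a hx

theorem eComp_letterHom {j : J} (a b c : (F.obj j).carrier) {x y z : ColimObj F}
    (hx : colimObj a = x) (hy : colimObj b = y) (hz : colimObj c = z) :
    eComp V a b c ≫ letterHom a c hx hz =
      (letterHom a b hx hy ⊗ₘ letterHom b c hy hz) ≫
        eComp V (colimCatObj x) (colimCatObj y) (colimCatObj z) :=
  eComp_letter a b c hx hy hz

/-- Together with `snocHom_colimAntipode`, this puts the last step of a word into the form `p * q`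
and its antipode into the form `q' * p'`, so that only cancellation in convolution remains. -/
theorem snocHom_eq_conv {y x z : ColimObj F} (w : Word F y x) {j : J}
    (a b : (F.obj j).carrier) (hx : colimObj a = x) (hz : colimObj b = z) :
    snocHom w a b hx hz = conv (tensorFst _ _ ≫ wordHom w) (tensorSnd _ _ ≫ letterHom a b hx hz) := by
  rw [conv_fst_snd, MonoidalCategory.tensorHom_def, Category.assoc]
  refine (wordι_colimAct a b hx hz w).symm.trans ?_
  exact congrArg (wordι w ▷ (a ⟶[V] b) ≫ ·) (letter_colimComp y a b hx hz).symm

theorem snocHom_colimAntipode {y x z : ColimObj F} (w : Word F y x) {j : J}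
    (a b : (F.obj j).carrier) (hx : colimObj a = x) (hz : colimObj b = z) :
    snocHom w a b hx hz ≫ colimAntipode hS y z =
      conv (tensorSnd _ _ ≫ S j a b ≫ letterHom b a hz hx)
        (tensorFst _ _ ≫ wordHom w ≫ colimAntipode hS y x) := by
  have h := (antipodeModule hS y).colimAct_liftUnit (y := y) (nilι y) a b hx hz
  rw [conv_snd_fst, MonoidalCategory.tensorHom_def', Category.assoc,
    ← BraidedCategory.braiding_naturality_left_assoc, comp_whiskerRight, Category.assoc]
  refine (congrArg (· ≫ _) (wordι_colimAct a b hx hz w).symm).trans ?_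
  exact (Category.assoc _ _ _).trans (congrArg (wordι w ▷ (a ⟶[V] b) ≫ ·) h)

/-- Induction on the word: `p * q * q' * p'` and `q' * p' * p * q` collapse from the inside, by the
antipode of the member containing the last letter and by the induction hypothesis. -/
theorem wordHom_conv_colimAntipode {y x : ColimObj F} (w : Word F y x) :
    conv (wordHom w) (wordHom w ≫ colimAntipode hS y x) = convUnit w.obj (colimCatObj y) ∧
      conv (wordHom w ≫ colimAntipode hS y x) (wordHom w) = convUnit w.obj (colimCatObj x) := by
  induction w with
  | nil =>
    have h : ∀ e : 𝟙_ V ⟶ (colimCatObj y ⟶[V] colimCatObj y), e = convUnit (𝟙_ V) (colimCatObj y) →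
        e ≫ colimAntipode hS y y = convUnit (𝟙_ V) (colimCatObj y) →
        conv e (e ≫ colimAntipode hS y y) = convUnit (𝟙_ V) (colimCatObj y) ∧
          conv (e ≫ colimAntipode hS y y) e = convUnit (𝟙_ V) (colimCatObj y) := by
      rintro e h₁ h₂
      rw [h₂, h₁]
      exact ⟨conv_convUnit _, conv_convUnit _⟩
    exact h (nilι y) (Category.id_comp _).symm
      (((antipodeModule hS y).nilι_liftUnit (y := y) (nilι y)).trans (Category.id_comp _).symm)
  | snoc w j a b hx hz ih =>
    rename_i x z
    let p : w.obj ⊗ (a ⟶[V] b) ⟶ _ := tensorFst _ _ ≫ wordHom w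
    let q : w.obj ⊗ (a ⟶[V] b) ⟶ _ := tensorSnd _ _ ≫ letterHom a b hx hz
    let q' : w.obj ⊗ (a ⟶[V] b) ⟶ _ := tensorSnd _ _ ≫ S j a b ≫ letterHom b a hz hx
    let p' : w.obj ⊗ (a ⟶[V] b) ⟶ _ := tensorFst _ _ ≫ wordHom w ≫ colimAntipode hS y x
    have hp : conv p p' = convUnit _ (colimCatObj y) := by rw [← comp_conv, ih.1, comp_convUnit]
    have hp' : conv p' p = convUnit _ (colimCatObj x) := by rw [← comp_conv, ih.2, comp_convUnit]
    have hq : conv q q' = convUnit _ (colimCatObj x) := by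
      rw [← comp_conv, ← Category.id_comp (letterHom a b hx hz),
        ← conv_comp _ _ _ _ _ (eComp_letterHom a b a hx hz hx), (hS j).conv_right, convUnit,
        Category.assoc, eId_letterHom]
      exact comp_convUnit _ _
    have hq' : conv q' q = convUnit _ (colimCatObj z) := by
      rw [← comp_conv, ← Category.id_comp (letterHom a b hx hz),
        ← conv_comp _ _ _ _ _ (eComp_letterHom b a b hz hx hz), (hS j).conv_left, convUnit,
        Category.assoc, eId_letterHom]
      exact comp_convUnit _ _
    have h₁ : conv (snocHom w a b hx hz) (snocHom w a b hx hz ≫ colimAntipode hS y z) =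
        convUnit _ (colimCatObj y) := by
      rw [snocHom_colimAntipode, snocHom_eq_conv]
      change conv (conv p q) (conv q' p') = _
      rw [conv_assoc, ← conv_assoc q, hq, convUnit_conv, hp]
    have h₂ : conv (snocHom w a b hx hz ≫ colimAntipode hS y z) (snocHom w a b hx hz) =
        convUnit _ (colimCatObj z) := by
      rw [snocHom_colimAntipode, snocHom_eq_conv]
      change conv (conv q' p') (conv p q) = _
      rw [conv_assoc, ← conv_assoc p', hp', convUnit_conv, hq']
    exact ⟨h₁, h₂⟩

theorem conv_colimAntipode (y x : ColimObj F) :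
    conv (𝟙 (colimCatObj y ⟶[V] colimCatObj x)) (colimAntipode hS y x) =
      convUnit _ (colimCatObj y) := by
  refine colimHom_ext (y := y) (x := x) fun w => ?_
  change wordHom w ≫ conv _ _ = wordHom w ≫ convUnit _ _
  rw [comp_conv, comp_convUnit, Category.comp_id, (wordHom_conv_colimAntipode hS w).1]

theorem colimAntipode_conv (y x : ColimObj F) :
    conv (colimAntipode hS y x) (𝟙 (colimCatObj y ⟶[V] colimCatObj x)) =
      convUnit _ (colimCatObj x) := by
  refine colimHom_ext (y := y) (x := x) fun w => ?_
  change wordHom w ≫ conv _ _ = wordHom w ≫ convUnit _ _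
  rw [comp_conv, comp_convUnit, Category.comp_id, (wordHom_conv_colimAntipode hS w).2]

theorem isAntipode_colimAntipode : (colimCat F).IsAntipode (colimAntipode hS) :=
  IsAntipode.of_conv (A := colimCat F) (conv_colimAntipode hS) (colimAntipode_conv hS)

end Antipode

theorem isHopf_isClosedUnderColimitsOfShape (J : Type v) [SmallCategory J] :
    (isHopf V).IsClosedUnderColimitsOfShape J where
  colimitsOfShape_le := by
    rintro X ⟨p⟩
    choose S hS using p.prop_diag_obj
    exact (isHopf V).prop_of_iso
      ((colimCoconeIsColimit p.diag).coconePointUniqueUpToIso p.isColimit)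
      ⟨_, isAntipode_colimAntipode hS⟩

theorem hopfCat_hasColimits : HasColimits (HopfCat V) where
  has_colimits_of_shape J _ := by
    have := isHopf_isClosedUnderColimitsOfShape (V := V) J
    have := hasColimits (V := V)
    infer_instance

theorem hopfCat_preservesColimits : PreservesColimits (isHopf V).ι where
  preservesColimitsOfShape {J} _ := by
    have := isHopf_isClosedUnderColimitsOfShape (V := V) J
    have := hasColimits (V := V)
    infer_instance

end SemiHopfCat

end

/-! ### Very flat tensor products and limits of comonoids -/

noncomputable section

theorem JointlyMonic.mono_lift {V : Type u} [Category.{v} V] {B P : V} {ι : Type v}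
    {X : ι → V} {β : ∀ i, B ⟶ X i}
    (hβ : JointlyMonic β) (m : B ⟶ P) (π : ∀ i, P ⟶ X i) (h : ∀ i, m ≫ π i = β i) : Mono m where
  right_cancellation f g w := hβ f g fun i => by rw [← h, reassoc_of% w]

section JointlyMonic

variable {V : Type u} [Category.{v} V] [MonoidalCategory V]

namespace VeryFlatTensor

theorem jointlyMonic_whiskerLeft [BraidedCategory V] (hV : VeryFlatTensor V) (A : V) {B : V}
    {ι : Type v} [Nonempty ι] {X : ι → V} {β : ∀ i, B ⟶ X i} (hβ : JointlyMonic β) :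
    JointlyMonic (fun i => A ◁ β i) := by
  intro W g h w
  rw [← cancel_mono (β_ A B).hom]
  refine hV A B ι X β hβ _ _ fun i => ?_
  rw [Category.assoc, Category.assoc, ← BraidedCategory.braiding_naturality_right,
    reassoc_of% w i]

/-- Very flatness is applied to one factor at a time. Later the index types are lists, which are
nonempty even over an empty diagram, so terminal objects need no separate treatment. -/
theorem jointlyMonic_tensorHom [BraidedCategory V] (hV : VeryFlatTensor V) {B C : V}
    {ι κ : Type v} [Nonempty ι] [Nonempty κ] {X : ι → V} {Y : κ → V} {β : ∀ i, B ⟶ X i}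
    {γ : ∀ k, C ⟶ Y k} (hβ : JointlyMonic β) (hγ : JointlyMonic γ) :
    JointlyMonic (fun i : ι × κ => β i.1 ⊗ₘ γ i.2) := by
  intro W g h w
  refine hV C B ι X β hβ _ _ fun i => hV.jointlyMonic_whiskerLeft (X i) hγ _ _ fun k => ?_
  simpa [MonoidalCategory.tensorHom_def] using w (i, k)

end VeryFlatTensor

end JointlyMonic

section WordMap

variable {V : Type u} [Category.{v} V] [MonoidalCategory V] {ι : Type v} (X : ι → V)

/-- The tensor product of a list of objects. -/
def tensorList : List ι → V
  | [] => 𝟙_ V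
  | j :: l => tensorList l ⊗ X j

/-- The tensor product of a concatenation. -/
def tensorListAppend (l : List ι) :
    ∀ l' : List ι, tensorList X l ⊗ tensorList X l' ≅ tensorList X (l' ++ l)
  | [] => ρ_ _
  | j :: l' => (α_ _ _ _).symm ≪≫ whiskerRightIso (tensorListAppend l l') (X j)

variable {X} {C D : V} [ComonObj C] [ComonObj D]

/-- The iterated comultiplication of a comonoid followed by a list of morphisms. -/
def comulList (p : ∀ j, C ⟶ X j) : ∀ l : List ι, C ⟶ tensorList X l
  | [] => ε[C]
  | j :: l => Δ[C] ≫ (comulList p l ⊗ₘ p j)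

/-- The tensor product of a list with one element. -/
def tensorListSingleton (j : ι) : tensorList X [j] ⟶ X j := (λ_ (X j)).hom

theorem comulList_singleton (p : ∀ j, C ⟶ X j) (j : ι) :
    comulList p [j] ≫ tensorListSingleton j = p j := by
  have h : Δ[C] ≫ (ε[C] ⊗ₘ p j) = p j ≫ (λ_ (X j)).inv := ComonObj.counit_comul_hom _
  exact (congrArg (· ≫ (λ_ (X j)).hom) h).trans (by simp)

/-- The inverse of `tensorListSingleton`. -/
def tensorListSingletonInv (j : ι) : X j ⟶ tensorList X [j] := (λ_ (X j)).inv

theorem comp_tensorListSingletonInv (p : ∀ j, C ⟶ X j) (j : ι) :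
    p j ≫ tensorListSingletonInv j = comulList p [j] :=
  (ComonObj.counit_comul_hom (p j)).symm

theorem comp_comulList (f : C ⟶ D) [IsComonHom f] (p : ∀ j, D ⟶ X j) (l : List ι) :
    f ≫ comulList p l = comulList (fun j => f ≫ p j) l := by
  induction l with
  | nil => exact IsComonHom.hom_counit f
  | cons j l ih =>
    have h : f ≫ Δ[D] ≫ (comulList p l ⊗ₘ p j) =
        Δ[C] ≫ (comulList (fun j => f ≫ p j) l ⊗ₘ (f ≫ p j)) := by
      rw [IsComonHom.hom_comul_assoc, tensorHom_comp_tensorHom, ih]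
    exact h

/-- Coassociativity. The head of a list labels the rightmost tensor factor, which is why the two
lists are concatenated in reversed order. -/
theorem comulList_append (p : ∀ j, C ⟶ X j) (l l' : List ι) :
    Δ[C] ≫ (comulList p l ⊗ₘ comulList p l') ≫ (tensorListAppend X l l').hom =
      comulList p (l' ++ l) := by
  induction l' with
  | nil =>
    have h : Δ[C] ≫ (comulList p l ⊗ₘ ε[C]) = comulList p l ≫ (ρ_ _).inv :=
      ComonObj.comul_counit_hom _
    exact ((Category.assoc _ _ _).symm.trans (congrArg (· ≫ (ρ_ _).hom) h)).trans (by simp)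
  | cons j l' ih =>
    have h : Δ[C] ≫ (comulList p l ⊗ₘ (Δ[C] ≫ (comulList p l' ⊗ₘ p j))) ≫ (α_ _ _ _).inv ≫
        (tensorListAppend X l l').hom ▷ X j = Δ[C] ≫ (comulList p (l' ++ l) ⊗ₘ p j) := by
      have h₁ : comulList p l ⊗ₘ (Δ[C] ≫ (comulList p l' ⊗ₘ p j)) =
          C ◁ Δ[C] ≫ (comulList p l ⊗ₘ (comulList p l' ⊗ₘ p j)) := by
        rw [← id_tensorHom, tensorHom_comp_tensorHom, Category.id_comp]
      have h₂ : (Δ[C] ≫ (comulList p l ⊗ₘ comulList p l') ≫ (tensorListAppend X l l').hom) ⊗ₘ p j =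
          Δ[C] ▷ C ≫ ((comulList p l ⊗ₘ comulList p l') ⊗ₘ p j) ≫
            (tensorListAppend X l l').hom ▷ X j := by
        rw [← tensorHom_id, ← tensorHom_id, tensorHom_comp_tensorHom, tensorHom_comp_tensorHom,
          Category.id_comp, Category.comp_id]
      rw [← ih, h₁, h₂, Category.assoc, ComonObj.comul_assoc_assoc, ← associator_naturality_assoc,
        Iso.hom_inv_id_assoc]
    exact h

theorem comul_tensorHom_comulList (p : ∀ j, C ⟶ X j) (l l' : List ι) :
    Δ[C] ≫ (comulList p l ⊗ₘ comulList p l') =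
      comulList p (l' ++ l) ≫ (tensorListAppend X l l').inv := by
  rw [← comulList_append, Category.assoc, Category.assoc, Iso.hom_inv_id, Category.comp_id]

/-- Comonoid morphisms can be tested on iterated comultiplications. -/
theorem isComonHom_of_comp_comulList [BraidedCategory V] (hV : VeryFlatTensor V)
    {p : ∀ j, D ⟶ X j} (hp : JointlyMonic (comulList p)) {q : ∀ j, C ⟶ X j} (f : C ⟶ D)
    (hf : ∀ l, f ≫ comulList p l = comulList q l) : IsComonHom f where
  hom_counit := hf []
  hom_comul := hV.jointlyMonic_tensorHom hp hp _ _ fun l => by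
    simp only [Category.assoc, tensorHom_comp_tensorHom, hf, comul_tensorHom_comulList]
    rw [← Category.assoc, hf]

theorem comp_eq_of_comp_comulList {p : ∀ j, D ⟶ X j} {q : ∀ j, C ⟶ X j} (f : C ⟶ D)
    (hf : ∀ l, f ≫ comulList p l = comulList q l) (j : ι) : f ≫ p j = q j := by
  rw [← comulList_singleton p, ← comulList_singleton q, ← hf, Category.assoc]

/-- Comonoid morphisms are determined by their composites with a separating family. -/
theorem comonHom_ext_of_jointlyMonic {p : ∀ j, D ⟶ X j} (hp : JointlyMonic (comulList p))
    (f g : C ⟶ D) [IsComonHom f] [IsComonHom g] (h : ∀ j, f ≫ p j = g ≫ p j) : f = g :=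
  hp f g fun l => by simp only [comp_comulList, h]

end WordMap

section Quotient

variable {V : Type u} [Category.{v} V] [MonoidalCategory V] {D E : V} [ComonObj D]

/-- The comonoid structure induced on a quotient of a comonoid. -/
@[reducible]
def quotientComon (e : D ⟶ E) [Epi e] (c : E ⟶ 𝟙_ V) (d : E ⟶ E ⊗ E) (hc : e ≫ c = ε[D])
    (hd : e ≫ d = Δ[D] ≫ (e ⊗ₘ e)) : ComonObj E where
  counit := c
  comul := d
  counit_comul := by
    rw [← cancel_epi e, ← Category.assoc, hd, Category.assoc, ← tensorHom_id,
      tensorHom_comp_tensorHom, hc, Category.comp_id, ComonObj.counit_comul_hom]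
  comul_counit := by
    rw [← cancel_epi e, ← Category.assoc, hd, Category.assoc, ← id_tensorHom,
      tensorHom_comp_tensorHom, hc, Category.comp_id, ComonObj.comul_counit_hom]
  comul_assoc := by
    have h₁ : e ⊗ₘ (Δ[D] ≫ (e ⊗ₘ e)) = D ◁ Δ[D] ≫ (e ⊗ₘ (e ⊗ₘ e)) := by
      rw [← id_tensorHom, tensorHom_comp_tensorHom, Category.id_comp]
    have h₂ : (Δ[D] ≫ (e ⊗ₘ e)) ⊗ₘ e = Δ[D] ▷ D ≫ ((e ⊗ₘ e) ⊗ₘ e) := by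
      rw [← tensorHom_id, tensorHom_comp_tensorHom, Category.id_comp]
    rw [← cancel_epi e, reassoc_of% hd, reassoc_of% hd, ← id_tensorHom, ← tensorHom_id,
      tensorHom_comp_tensorHom, tensorHom_comp_tensorHom_assoc, hd, Category.comp_id, h₁, h₂,
      ComonObj.comul_assoc_assoc, Category.assoc, associator_naturality]

theorem isComonHom_of_epi_comp {F : V} [ComonObj E] [ComonObj F] (e : D ⟶ E) [Epi e]
    [IsComonHom e] (f : E ⟶ F) [IsComonHom (e ≫ f)] : IsComonHom f where
  hom_counit := by
    rw [← cancel_epi e, ← Category.assoc, IsComonHom.hom_counit, IsComonHom.hom_counit]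
  hom_comul := by
    rw [← cancel_epi e, ← Category.assoc, IsComonHom.hom_comul, IsComonHom.hom_comul_assoc,
      tensorHom_comp_tensorHom]

end Quotient

section Coproduct

variable {V : Type u} [Category.{v} V] [MonoidalCategory V] {ι : Type v} (C : ι → V)
  [∀ i, ComonObj (C i)] [HasColimits V]

/-- The coproduct of a family of comonoids is a comonoid. -/
@[reducible]
def sigmaComon : ComonObj (∐ C) where
  counit := Sigma.desc fun i => ε[C i]
  comul := Sigma.desc fun i => Δ[C i] ≫ (Sigma.ι C i ⊗ₘ Sigma.ι C i)
  counit_comul := Sigma.hom_ext _ _ fun i => by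
    rw [Sigma.ι_desc_assoc, Category.assoc, ← tensorHom_id, tensorHom_comp_tensorHom, Sigma.ι_desc,
      Category.comp_id, ComonObj.counit_comul_hom]
  comul_counit := Sigma.hom_ext _ _ fun i => by
    rw [Sigma.ι_desc_assoc, Category.assoc, ← id_tensorHom, tensorHom_comp_tensorHom, Sigma.ι_desc,
      Category.comp_id, ComonObj.comul_counit_hom]
  comul_assoc := Sigma.hom_ext _ _ fun i => by
    have h₁ : Sigma.ι C i ⊗ₘ (Δ ≫ (Sigma.ι C i ⊗ₘ Sigma.ι C i)) =
        C i ◁ Δ ≫ (Sigma.ι C i ⊗ₘ (Sigma.ι C i ⊗ₘ Sigma.ι C i)) := by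
      rw [← id_tensorHom, tensorHom_comp_tensorHom, Category.id_comp]
    have h₂ : (Δ ≫ (Sigma.ι C i ⊗ₘ Sigma.ι C i)) ⊗ₘ Sigma.ι C i =
        Δ ▷ C i ≫ ((Sigma.ι C i ⊗ₘ Sigma.ι C i) ⊗ₘ Sigma.ι C i) := by
      rw [← tensorHom_id, tensorHom_comp_tensorHom, Category.id_comp]
    rw [Sigma.ι_desc_assoc, Sigma.ι_desc_assoc, Category.assoc, Category.assoc, ← id_tensorHom,
      ← tensorHom_id, tensorHom_comp_tensorHom, tensorHom_comp_tensorHom_assoc, Sigma.ι_desc,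
      Category.comp_id, h₁, h₂, ComonObj.comul_assoc_assoc, Category.assoc, associator_naturality]

attribute [local instance] sigmaComon

theorem sigmaι_isComonHom (i : ι) : IsComonHom (Sigma.ι C i) where
  hom_counit := Sigma.ι_desc _ _
  hom_comul := Sigma.ι_desc _ _

attribute [local instance] sigmaι_isComonHom

theorem isComonHom_sigma {F : V} [ComonObj F] (f : ∐ C ⟶ F)
    (h : ∀ i, IsComonHom (Sigma.ι C i ≫ f)) : IsComonHom f where
  hom_counit := Sigma.hom_ext _ _ fun i => by
    have := h i
    rw [← Category.assoc, IsComonHom.hom_counit, IsComonHom.hom_counit]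
  hom_comul := Sigma.hom_ext _ _ fun i => by
    have := h i
    rw [← Category.assoc, IsComonHom.hom_comul, IsComonHom.hom_comul_assoc,
      tensorHom_comp_tensorHom]

end Coproduct

section ComonCone

variable {V : Type u} [Category.{v} V] [MonoidalCategory V]
  {J : Type v} [SmallCategory J] (X : J → V) [∀ j, ComonObj (X j)]
  (c : ∀ {j k : J}, (j ⟶ k) → (X j ⟶ X k))

/-- A cone of comonoids over a family of morphisms between comonoids. -/
structure ComonCone where
  /-- The apex. -/
  pt : V
  /-- The comonoid structure of the apex. -/
  [comon : ComonObj pt]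
  /-- The components. -/
  π : ∀ j, pt ⟶ X j
  isComonHom : ∀ j, IsComonHom (π j)
  w : ∀ {j k : J} (f : j ⟶ k), π j ≫ c f = π k

attribute [instance] ComonCone.comon ComonCone.isComonHom

variable {X c}

namespace ComonCone

variable [HasLimits V]

/-- The canonical morphism of a cone to the product of all tensor products of lists. -/
def toProd (D : ComonCone X c) : D.pt ⟶ ∏ᶜ tensorList X := Pi.lift (comulList D.π)

theorem mono_toProd {D : ComonCone X c} (hD : JointlyMonic (comulList D.π)) : Mono D.toProd :=
  hD.mono_lift _ (Pi.π _) fun _ => Pi.lift_π _ _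

variable [BraidedCategory V] [WellPowered.{v} V]

/-- Every cone of comonoids has a separated quotient. -/
theorem exists_separated (hV : VeryFlatTensor V) (D : ComonCone X c) :
    ∃ (E : ComonCone X c) (e : D.pt ⟶ E.pt), JointlyMonic (comulList E.π) ∧ IsComonHom e ∧
      ∀ j, e ≫ E.π j = D.π j := by
  -- `E` is the image of `D` in the product of all tensor words; it identifies exactly what those
  -- words cannot distinguish.
  obtain ⟨E, e, m, he, hm, fac⟩ :=
    exists_strongEpi_mono_factorization (Pi.lift (comulList D.π))
  let w : ∀ l, E ⟶ tensorList X l := fun l => m ≫ Pi.π _ l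
  have hew : ∀ l, e ≫ w l = comulList D.π l := fun l => by
    rw [← Category.assoc, fac, Pi.lift_π]
  have hw : JointlyMonic w := fun W f g h => by
    rw [← cancel_mono m]
    exact Pi.hom_ext _ _ fun l => by simpa [w] using h l
  let n : E ⊗ E ⟶ ∏ᶜ fun l : List J × List J => tensorList X l.1 ⊗ tensorList X l.2 :=
    Pi.lift fun l => w l.1 ⊗ₘ w l.2
  have : Mono n := (hV.jointlyMonic_tensorHom hw hw).mono_lift n (fun l => Pi.π _ l)
    fun l => Pi.lift_π _ _
  -- The comultiplication of `E` is the diagonal filler of this square. Very flatness made `n`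
  -- monic, and splitting a word in two, as in `comulList_append`, provides the bottom edge.
  have sq : CommSq (Δ[D.pt] ≫ (e ⊗ₘ e)) e n
      (Pi.lift fun l => w (l.2 ++ l.1) ≫ (tensorListAppend X l.1 l.2).inv) := ⟨by
    refine Pi.hom_ext _ _ fun l => ?_
    simp only [n, Category.assoc, Pi.lift_π, tensorHom_comp_tensorHom, hew, reassoc_of% hew,
      comul_tensorHom_comulList]⟩
  have hl : sq.HasLift := inferInstance
  let : ComonObj E := quotientComon e (w []) sq.lift (hew []) sq.fac_left
  have he' : IsComonHom e := ⟨hew [], sq.fac_left⟩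
  let p : ∀ j, E ⟶ X j := fun j => w [j] ≫ tensorListSingleton j
  have hp : ∀ j, e ≫ p j = D.π j := fun j => by
    rw [reassoc_of% hew, comulList_singleton]
  -- The iterated comultiplications of the new structure are the original components of `m`, as seen
  -- after precomposing with the epimorphism `e`.
  have hpw : comulList p = w := by
    funext l
    rw [← cancel_epi e, hew, comp_comulList]
    simp only [hp]
  refine ⟨⟨E, p, fun j => ?_, fun f => ?_⟩, e, ?_, he', hp⟩
  · have : IsComonHom (e ≫ p j) := by rw [hp]; infer_instance
    exact isComonHom_of_epi_comp e (p j)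
  · rw [← cancel_epi e, ← Category.assoc, hp, hp, D.w]
  · exact hpw ▸ hw

/-- Over a very flat monoidal product, there is a separated cone of comonoids to which every cone
maps. -/
theorem exists_terminal [HasColimits V] (hV : VeryFlatTensor V) (X : J → V)
    [∀ j, ComonObj (X j)] (c : ∀ {j k : J}, (j ⟶ k) → (X j ⟶ X k)) :
    ∃ L : ComonCone X c, JointlyMonic (comulList L.π) ∧
      ∀ D : ComonCone X c, ∃ f : D.pt ⟶ L.pt, IsComonHom f ∧ ∀ j, f ≫ L.π j = D.π j := by
  -- A separated cone is determined up to isomorphism by its subobject of the product of tensor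
  -- words, so one representative per subobject yields a small family.
  let T := {s : Subobject (∏ᶜ tensorList X) // ∃ (E : ComonCone X c)
    (hE : JointlyMonic (comulList E.π)), haveI := mono_toProd hE; Subobject.mk E.toProd = s}
  have : Small.{v} (Subobject (∏ᶜ tensorList X)) := WellPowered.subobject_small _
  have : Small.{v} T := small_subtype _ _
  choose E hE hE' using fun t : T => t.2
  let C : Shrink.{v} T → V := fun t => (E ((equivShrink T).symm t)).pt
  let : ∀ t, ComonObj (C t) := fun t => inferInstanceAs (ComonObj (E ((equivShrink T).symm t)).pt)
  let : ComonObj (∐ C) := sigmaComon C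
  let S : ComonCone X c :=
    { pt := ∐ C
      π := fun j => Sigma.desc fun t => (E ((equivShrink T).symm t)).π j
      isComonHom := fun j => isComonHom_sigma C _ fun t => by
        rw [Sigma.ι_desc]; exact (E ((equivShrink T).symm t)).isComonHom j
      w := fun f => Sigma.hom_ext _ _ fun t => by
        rw [Sigma.ι_desc_assoc, Sigma.ι_desc, ComonCone.w] }
  -- The coproduct receives all representatives, and separating it makes comonoid morphisms of cones
  -- into it unique.
  obtain ⟨L, q, hL, hq, hq'⟩ := exists_separated hV S
  refine ⟨L, hL, fun D => ?_⟩
  obtain ⟨D', e, hD', he, he'⟩ := exists_separated hV D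
  have := mono_toProd hD'
  let t : T := ⟨Subobject.mk D'.toProd, D', hD', rfl⟩
  have := mono_toProd (hE t)
  -- `D'` and the chosen representative present the same subobject. The comparison commutes with all
  -- tensor words, hence is a comonoid morphism.
  let i : D'.pt ⟶ (E t).pt := Subobject.ofMkLEMk D'.toProd (E t).toProd (hE' t).ge
  have hi : ∀ l, i ≫ comulList (E t).π l = comulList D'.π l := fun l => by
    have h : i ≫ (E t).toProd = D'.toProd := Subobject.ofMkLEMk_comp _
    simpa [toProd] using h =≫ Pi.π _ l
  have hi₁ : IsComonHom i := isComonHom_of_comp_comulList hV (hE t) i hi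
  obtain ⟨s, hs⟩ : ∃ s, (equivShrink T).symm s = t := (equivShrink T).symm.surjective t
  have hk : ∃ k : (E t).pt ⟶ S.pt, IsComonHom k ∧ ∀ j, k ≫ S.π j = (E t).π j := by
    rw [← hs]
    exact ⟨Sigma.ι C s, sigmaι_isComonHom C s, fun j => Sigma.ι_desc _ _⟩
  obtain ⟨k, hk₁, hk₂⟩ := hk
  refine ⟨e ≫ i ≫ k ≫ q, inferInstance, fun j => ?_⟩
  rw [Category.assoc, Category.assoc, Category.assoc, hq', hk₂,
    comp_eq_of_comp_comulList i hi j, he']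

end ComonCone

end ComonCone

end

/-! ### Co-opposite comonoids, tensor products of enriched categories, antipodes and
comultiplication -/

noncomputable section

section CoOpposite

variable {V : Type u} [Category.{v} V] [MonoidalCategory V] [BraidedCategory V] {C D : V}

variable (C) in
/-- The co-opposite of a comonoid. -/
@[reducible]
def copComon [ComonObj C] : ComonObj C where
  counit := ε[C]
  comul := Δ[C] ≫ (β_ C C).hom
  counit_comul := by
    rw [Category.assoc, ← BraidedCategory.braiding_naturality_right, ComonObj.comul_counit_assoc]
    simp
  comul_counit := by
    rw [Category.assoc, ← BraidedCategory.braiding_naturality_left, ComonObj.counit_comul_assoc]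
    simp
  comul_assoc := by
    have h := BraidedCategory.yang_baxter C C C
    rw [Category.assoc, Category.assoc, ← BraidedCategory.braiding_naturality_left,
      ← BraidedCategory.braiding_naturality_right_assoc, comp_whiskerRight,
      MonoidalCategory.whiskerLeft_comp, Category.assoc, Category.assoc,
      ComonObj.comul_assoc_assoc, BraidedCategory.braiding_tensor_left_hom,
      BraidedCategory.braiding_tensor_right_hom]
    simp only [Category.assoc, Iso.inv_hom_id, Category.comp_id] at h ⊢
    rw [Iso.inv_comp_eq] at h
    rw [h]

theorem isComonHom_copComon [ComonObj C] [ComonObj D] (f : C ⟶ D) (h : f ≫ ε[D] = ε[C])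
    (h' : f ≫ Δ[D] = Δ[C] ≫ (β_ C C).hom ≫ (f ⊗ₘ f)) :
    @IsComonHom V _ _ C D (copComon C) _ f :=
  @IsComonHom.mk V _ _ C D (copComon C) _ f h (h'.trans (Category.assoc _ _ _).symm)

end CoOpposite

section Coherence

variable {V : Type u} [Category.{v} V] [MonoidalCategory V] [BraidedCategory V] (X Y : V)

theorem rightUnitor_inv_tensorμ :
    ((ρ_ X).inv ⊗ₘ (ρ_ Y).inv) ≫ tensorμ X (𝟙_ V) Y (𝟙_ V) =
      (ρ_ (X ⊗ Y)).inv ≫ (X ⊗ Y) ◁ (λ_ (𝟙_ V)).inv := by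
  rw [← cancel_mono ((X ⊗ Y) ◁ (λ_ (𝟙_ V)).hom ≫ (ρ_ (X ⊗ Y)).hom), Category.assoc,
    ← rightUnitor_monoidal]
  simp

theorem leftUnitor_inv_tensorμ :
    ((λ_ X).inv ⊗ₘ (λ_ Y).inv) ≫ tensorμ (𝟙_ V) X (𝟙_ V) Y =
      (λ_ (X ⊗ Y)).inv ≫ (λ_ (𝟙_ V)).inv ▷ (X ⊗ Y) := by
  rw [← cancel_mono ((λ_ (𝟙_ V)).hom ▷ (X ⊗ Y) ≫ (λ_ (X ⊗ Y)).hom), Category.assoc,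
    ← leftUnitor_monoidal]
  simp

theorem rightUnitor_inv_leftUnitor_inv_tensorμ :
    ((ρ_ X).inv ⊗ₘ (λ_ Y).inv) ≫ tensorμ X (𝟙_ V) (𝟙_ V) Y = ((ρ_ X).inv ⊗ₘ (λ_ Y).inv) := by
  have : (β_ (𝟙_ V) (𝟙_ V)).hom = 𝟙 _ := by
    rw [braiding_tensorUnit_left, ← unitors_inv_equal, Iso.hom_inv_id]
  rw [tensorμ, this]
  monoidal

theorem leftUnitor_inv_rightUnitor_inv_tensorμ :
    ((λ_ X).inv ⊗ₘ (ρ_ Y).inv) ≫ tensorμ (𝟙_ V) X Y (𝟙_ V) =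
      (β_ X Y).hom ≫ ((λ_ Y).inv ⊗ₘ (ρ_ X).inv) := by
  rw [tensorμ]
  monoidal

end Coherence

/-- The objects of the product of two enriched categories. -/
structure EnrichedProd (A : Type w) (B : Type w') where
  /-- The first component. -/
  fst : A
  /-- The second component. -/
  snd : B

namespace EnrichedProd

variable {V : Type u} [Category.{v} V] [MonoidalCategory V] [BraidedCategory V]
  {A : Type w} {B : Type w'} [EnrichedCategory V A] [EnrichedCategory V B]

instance : EnrichedCategory V (EnrichedProd A B) where
  Hom x y := (x.fst ⟶[V] y.fst) ⊗ (x.snd ⟶[V] y.snd)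
  id x := (λ_ _).inv ≫ (eId V x.fst ⊗ₘ eId V x.snd)
  comp x y z := tensorμ _ _ _ _ ≫ (eComp V _ _ _ ⊗ₘ eComp V _ _ _)
  id_comp x y := by
    rw [Iso.inv_comp_eq, Category.comp_id, tensor_left_unitality, comp_whiskerRight,
      Category.assoc, tensorμ_natural_left_assoc, tensorHom_comp_tensorHom,
      ← (Iso.inv_comp_eq_id _).1 (e_id_comp V x.fst y.fst), ← (Iso.inv_comp_eq_id _).1 (e_id_comp V x.snd y.snd)]
  comp_id x y := by
    rw [Iso.inv_comp_eq, Category.comp_id, tensor_right_unitality,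
      MonoidalCategory.whiskerLeft_comp, Category.assoc, tensorμ_natural_right_assoc,
      tensorHom_comp_tensorHom, ← (Iso.inv_comp_eq_id _).1 (e_comp_id V x.fst y.fst),
      ← (Iso.inv_comp_eq_id _).1 (e_comp_id V x.snd y.snd)]
  assoc x y z t := by
    rw [Iso.inv_comp_eq, comp_whiskerRight, Category.assoc, tensorμ_natural_left_assoc,
      tensorHom_comp_tensorHom, ← e_assoc', ← e_assoc', ← tensorHom_comp_tensorHom,
      reassoc_of% @tensor_associativity, MonoidalCategory.whiskerLeft_comp, Category.assoc,
      tensorμ_natural_right_assoc, tensorHom_comp_tensorHom]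

variable (V) in
/-- The Hom-objects of a product are tensor products. -/
def tensorToHom (x y : A) (x' y' : B) :
    (x ⟶[V] y) ⊗ (x' ⟶[V] y') ⟶ ((⟨x, x'⟩ : EnrichedProd A B) ⟶[V] ⟨y, y'⟩) := 𝟙 _

instance (x y : A) (x' y' : B) : Mono (tensorToHom V x y x' y') := inferInstanceAs (Mono (𝟙 _))

theorem tensorToHom_eComp (x y z : A) (x' y' z' : B) :
    (tensorToHom V x y x' y' ⊗ₘ tensorToHom V y z y' z') ≫ eComp V _ _ _ =
      tensorμ _ _ _ _ ≫ (eComp V x y z ⊗ₘ eComp V x' y' z') ≫ tensorToHom V x z x' z' := by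
  refine (congrArg (· ≫ _) (id_tensorHom_id _ _)).trans ((Category.id_comp _).trans ?_)
  exact congrArg (_ ≫ ·) (Category.comp_id _).symm

theorem eId_tensorToHom (x : A) (x' : B) :
    (λ_ _).inv ≫ (eId V x ⊗ₘ eId V x') ≫ tensorToHom V x x x' x' =
      eId V (⟨x, x'⟩ : EnrichedProd A B) :=
  congrArg (_ ≫ ·) (Category.comp_id _)

variable (V) in
/-- The inclusion of the first factor at an object of the second factor. -/
def inl (x y : A) (b : B) : (x ⟶[V] y) ⟶ ((⟨x, b⟩ : EnrichedProd A B) ⟶[V] ⟨y, b⟩) :=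
  (ρ_ _).inv ≫ (𝟙 _ ⊗ₘ eId V b) ≫ tensorToHom V x y b b

variable (V) in
/-- The inclusion of the second factor at an object of the first factor. -/
def inr (a : A) (x y : B) : (x ⟶[V] y) ⟶ ((⟨a, x⟩ : EnrichedProd A B) ⟶[V] ⟨a, y⟩) :=
  (λ_ _).inv ≫ (eId V a ⊗ₘ 𝟙 _) ≫ tensorToHom V a a x y

theorem eId_inl (x : A) (b : B) : eId V x ≫ inl V x x b = eId V _ := by
  rw [inl, ← eId_tensorToHom, rightUnitor_inv_naturality_assoc, ← tensorHom_id,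
    tensorHom_comp_tensorHom_assoc, Category.comp_id, Category.id_comp, unitors_inv_equal]

theorem eId_inr (a : A) (x : B) : eId V x ≫ inr V a x x = eId V _ := by
  rw [inr, ← eId_tensorToHom, leftUnitor_inv_naturality_assoc, ← id_tensorHom,
    tensorHom_comp_tensorHom_assoc, Category.comp_id, Category.id_comp]

theorem eComp_inl (x y z : A) (b : B) :
    eComp V x y z ≫ inl V x z b = (inl V x y b ⊗ₘ inl V y z b) ≫ eComp V _ _ _ := by
  simp only [inl, ← tensorHom_comp_tensorHom, Category.assoc, tensorToHom_eComp, tensorμ_natural_assoc]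
  rw [reassoc_of% rightUnitor_inv_tensorμ (x ⟶[V] y) (y ⟶[V] z), tensorHom_comp_tensorHom_assoc,
    eId_tensorHom_eComp, id_tensorHom_id, Category.id_comp, ← id_tensorHom,
    tensorHom_comp_tensorHom_assoc, Iso.inv_hom_id_assoc, rightUnitor_inv_naturality_assoc,
    ← tensorHom_id, tensorHom_comp_tensorHom_assoc]
  simp

theorem eComp_inr (a : A) (x y z : B) :
    eComp V x y z ≫ inr V a x z = (inr V a x y ⊗ₘ inr V a y z) ≫ eComp V _ _ _ := by
  simp only [inr, ← tensorHom_comp_tensorHom, Category.assoc, tensorToHom_eComp, tensorμ_natural_assoc]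
  rw [reassoc_of% leftUnitor_inv_tensorμ (x ⟶[V] y) (y ⟶[V] z), tensorHom_comp_tensorHom_assoc,
    eId_tensorHom_eComp, id_tensorHom_id, Category.id_comp, ← tensorHom_id,
    tensorHom_comp_tensorHom_assoc, Iso.inv_hom_id_assoc, leftUnitor_inv_naturality_assoc,
    ← id_tensorHom, tensorHom_comp_tensorHom_assoc]
  simp

/-- In elements, `(a ⊗ 1)(1 ⊗ b) = a ⊗ b`. With the next lemma, where the factors come in the other
order and a braiding appears, this turns pairings into convolutions. -/
theorem inl_inr_eComp (x y : A) (x' y' : B) :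
    (inl V x y x' ⊗ₘ inr V y x' y') ≫ eComp V _ _ _ = tensorToHom V x y x' y' := by
  simp only [inl, inr, ← tensorHom_comp_tensorHom, Category.assoc, tensorToHom_eComp,
    tensorμ_natural_assoc]
  rw [reassoc_of% rightUnitor_inv_leftUnitor_inv_tensorμ (x ⟶[V] y) (x' ⟶[V] y'),
    tensorHom_comp_tensorHom_assoc, tensorHom_comp_tensorHom_assoc, Category.assoc, Category.assoc,
    tensorHom_eId_eComp, eId_tensorHom_eComp]
  simp

theorem inr_inl_eComp (x y : A) (x' y' : B) :
    (inr V x x' y' ⊗ₘ inl V x y y') ≫ eComp V _ _ _ = (β_ _ _).hom ≫ tensorToHom V x y x' y' := by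
  simp only [inl, inr, ← tensorHom_comp_tensorHom, Category.assoc, tensorToHom_eComp,
    tensorμ_natural_assoc]
  rw [reassoc_of% leftUnitor_inv_rightUnitor_inv_tensorμ (x' ⟶[V] y') (x ⟶[V] y),
    tensorHom_comp_tensorHom_assoc, tensorHom_comp_tensorHom_assoc, Category.assoc, Category.assoc,
    tensorHom_eId_eComp, eId_tensorHom_eComp]
  simp

variable {C : V} [ComonObj C]

/-- The pairing of two morphisms from a comonoid. -/
def pairing {x y : A} {x' y' : B} (f : C ⟶ (x ⟶[V] y)) (g : C ⟶ (x' ⟶[V] y')) :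
    C ⟶ ((⟨x, x'⟩ : EnrichedProd A B) ⟶[V] ⟨y, y'⟩) :=
  Δ[C] ≫ (f ⊗ₘ g) ≫ tensorToHom V x y x' y'

theorem conv_inl_inr {x y : A} {x' y' : B} (f : C ⟶ (x ⟶[V] y)) (g : C ⟶ (x' ⟶[V] y')) :
    conv (f ≫ inl V x y x') (g ≫ inr V y x' y') = pairing f g := by
  rw [conv, ← tensorHom_comp_tensorHom, Category.assoc, inl_inr_eComp, pairing]

theorem conv_inr_inl {x y : A} {x' y' : B} (f : C ⟶ (x ⟶[V] y)) (g : C ⟶ (x' ⟶[V] y')) :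
    conv (g ≫ inr V x x' y') (f ≫ inl V x y y') =
      Δ[C] ≫ (β_ C C).hom ≫ (f ⊗ₘ g) ≫ tensorToHom V x y x' y' := by
  rw [conv, ← tensorHom_comp_tensorHom, Category.assoc, inr_inl_eComp,
    BraidedCategory.braiding_naturality_assoc]

end EnrichedProd

namespace SemiHopfCat

open EnrichedProd

variable {V : Type u} [Category.{v} V] [MonoidalCategory V] [BraidedCategory V]

section

variable {A : SemiHopfCat V} {B : Type w} {B' : Type w'} [EnrichedCategory V B]
  [EnrichedCategory V B']

/-- The pairing of two enriched functors out of a semi-Hopf category is functorial. -/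
theorem eComp_pairing {x y z : A.carrier} {x₁ y₁ z₁ : B} {x₂ y₂ z₂ : B'}
    (p : (x ⟶[V] y) ⟶ (x₁ ⟶[V] y₁)) (p' : (y ⟶[V] z) ⟶ (y₁ ⟶[V] z₁))
    (p'' : (x ⟶[V] z) ⟶ (x₁ ⟶[V] z₁)) (q : (x ⟶[V] y) ⟶ (x₂ ⟶[V] y₂))
    (q' : (y ⟶[V] z) ⟶ (y₂ ⟶[V] z₂)) (q'' : (x ⟶[V] z) ⟶ (x₂ ⟶[V] z₂))
    (hp : eComp V x y z ≫ p'' = (p ⊗ₘ p') ≫ eComp V x₁ y₁ z₁)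
    (hq : eComp V x y z ≫ q'' = (q ⊗ₘ q') ≫ eComp V x₂ y₂ z₂) :
    eComp V x y z ≫ pairing p'' q'' = (pairing p q ⊗ₘ pairing p' q') ≫ eComp V _ _ _ := by
  simp only [pairing]
  rw [reassoc_of% A.comp_comul x y z, tensorHom_comp_tensorHom_assoc, hp, hq,
    ← tensorHom_comp_tensorHom, ← tensorHom_comp_tensorHom, ← tensorHom_comp_tensorHom,
    Category.assoc, Category.assoc, Category.assoc, tensorToHom_eComp, tensorμ_natural_assoc]

theorem eId_pairing {x : A.carrier} {x₁ : B} {x₂ : B'} (p : (x ⟶[V] x) ⟶ (x₁ ⟶[V] x₁))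
    (q : (x ⟶[V] x) ⟶ (x₂ ⟶[V] x₂)) (hp : eId V x ≫ p = eId V x₁) (hq : eId V x ≫ q = eId V x₂) :
    eId V x ≫ pairing p q = eId V _ := by
  rw [pairing, reassoc_of% A.id_comul x, tensorHom_comp_tensorHom_assoc, hp, hq, eId_tensorToHom]

end

/-- An antipode reverses comultiplications. -/
theorem IsAntipode.comp_comul {A : SemiHopfCat V}
    {S : ∀ x y : A.carrier, (x ⟶[V] y) ⟶ (y ⟶[V] x)} (hS : A.IsAntipode S) (x y : A.carrier) :
    S x y ≫ Δ[y ⟶[V] x] = Δ[x ⟶[V] y] ≫ (β_ _ _).hom ≫ (S x y ⊗ₘ S x y) := by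
  have hid : ∀ x y z : A.carrier, eComp V x y z ≫ 𝟙 _ = (𝟙 _ ⊗ₘ 𝟙 _) ≫ eComp V x y z :=
    fun x y z => by simp
  -- The pairing of two identities is the comultiplication, viewed as a functor from `A` to the
  -- product of `A` with itself.
  have hc : ∀ x y z : A.carrier, _ := fun x y z =>
    eComp_pairing (𝟙 (x ⟶[V] y)) (𝟙 (y ⟶[V] z)) (𝟙 (x ⟶[V] z)) (𝟙 _) (𝟙 _) (𝟙 _)
      (hid x y z) (hid x y z)
  have h₁ : conv (S x y ≫ pairing (𝟙 _) (𝟙 _)) (pairing (𝟙 (x ⟶[V] y)) (𝟙 (x ⟶[V] y))) =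
      convUnit _ _ := by
    have h := conv_comp (S x y) (𝟙 _) _ _ _ (hc y x y)
    rw [Category.id_comp] at h
    rw [← h, hS.conv_left, convUnit, Category.assoc,
      eId_pairing (𝟙 _) (𝟙 _) (Category.comp_id _) (Category.comp_id _), convUnit]
  have h₂ : conv (pairing (𝟙 (x ⟶[V] y)) (𝟙 (x ⟶[V] y)))
      (Δ[x ⟶[V] y] ≫ (β_ _ _).hom ≫ (S x y ⊗ₘ S x y) ≫ tensorToHom V y x y x) = convUnit _ _ := by
    have h₁ := conv_comp (𝟙 (x ⟶[V] y)) (S x y) _ _ _ (eComp_inl x y x x)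
    have h₂ := conv_comp (𝟙 (x ⟶[V] y)) (S x y) _ _ _ (eComp_inr y x y x)
    -- The product is `(x₁ ⊗ 1)(1 ⊗ x₂)(1 ⊗ S(x₃))(S(x₄) ⊗ 1)`: the two inner factors cancel, then
    -- the outer ones.
    rw [← conv_inl_inr, ← conv_inr_inl, conv_assoc, ← conv_assoc (𝟙 _ ≫ inr V _ _ _), ← h₂,
      hS.conv_right, convUnit, Category.assoc, eId_inr, ← convUnit, convUnit_conv, ← h₁,
      hS.conv_right, convUnit, Category.assoc, eId_inl, convUnit]
  have h := eq_of_conv_eq_convUnit h₁ h₂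
  simp only [pairing, id_tensorHom_id, Category.id_comp] at h
  rw [← cancel_mono (tensorToHom V y x y x)]
  simpa only [Category.assoc] using h

section

variable {L A : SemiHopfCat V}

/-- A right inverse of the identity is tested after applying a functor to its second factor. -/
theorem conv_comp_pairing_onHom_right
    {S : ∀ x y : A.carrier, (x ⟶[V] y) ⟶ (y ⟶[V] x)} (hS : A.IsAntipode S) (G : L ⟶ A)
    {x y : L.carrier} {x' y' : A.carrier} (hx : onObj G x = x') (hy : onObj G y = y')
    (s : (x ⟶[V] y) ⟶ (y ⟶[V] x))
    (hs : s ≫ Δ[y ⟶[V] x] = Δ[x ⟶[V] y] ≫ (β_ _ _).hom ≫ (s ⊗ₘ s))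
    (hG : s ≫ onHom G hy hx = onHom G hx hy ≫ S x' y') :
    conv (𝟙 _) s ≫ pairing (𝟙 (x ⟶[V] x)) (onHom G hx hx) = conv (𝟙 _) s ≫ inl V x x x' := by
  have hc := eComp_pairing (𝟙 (x ⟶[V] y)) (𝟙 (y ⟶[V] x)) (𝟙 (x ⟶[V] x)) _ _ _ (by simp)
    (onHom_comp G hx hy hx)
  have h₁ := conv_comp (𝟙 _) s _ _ _ (eComp_inl x y x x')
  have h₂ := conv_comp (onHom G hx hy) (onHom G hx hy ≫ S x' y') _ _ _ (eComp_inr y x' y' x')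
  have h₃ : s ≫ pairing (𝟙 (y ⟶[V] x)) (onHom G hy hx) =
      conv ((onHom G hx hy ≫ S x' y') ≫ inr V y y' x') (s ≫ inl V y x x') := by
    rw [conv_inr_inl, pairing, reassoc_of% hs, tensorHom_comp_tensorHom_assoc, hG, Category.comp_id]
  rw [conv_comp _ _ _ _ _ hc, Category.id_comp, h₃, ← conv_inl_inr, conv_assoc,
    ← conv_assoc (onHom G hx hy ≫ _), ← h₂, hS.conv_right_of_isComonHom, convUnit, Category.assoc,
    eId_inr, ← convUnit, convUnit_conv, ← h₁]

/-- A left inverse of the identity is tested after applying a functor to its first factor. -/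
theorem conv_comp_pairing_onHom_left
    {S : ∀ x y : A.carrier, (x ⟶[V] y) ⟶ (y ⟶[V] x)} (hS : A.IsAntipode S) (G : L ⟶ A)
    {x y : L.carrier} {x' y' : A.carrier} (hx : onObj G x = x') (hy : onObj G y = y')
    (s : (x ⟶[V] y) ⟶ (y ⟶[V] x))
    (hs : s ≫ Δ[y ⟶[V] x] = Δ[x ⟶[V] y] ≫ (β_ _ _).hom ≫ (s ⊗ₘ s))
    (hG : s ≫ onHom G hy hx = onHom G hx hy ≫ S x' y') :
    conv s (𝟙 _) ≫ pairing (onHom G hy hy) (𝟙 (y ⟶[V] y)) = conv s (𝟙 _) ≫ inr V y' y y := by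
  have hc := eComp_pairing _ _ _ (𝟙 (y ⟶[V] x)) (𝟙 (x ⟶[V] y)) (𝟙 (y ⟶[V] y))
    (onHom_comp G hy hx hy) (by simp)
  have h₁ := conv_comp s (𝟙 _) _ _ _ (eComp_inr y' y x y)
  have h₂ := conv_comp (onHom G hx hy ≫ S x' y') (onHom G hx hy) _ _ _ (eComp_inl y' x' y' x)
  have h₃ : s ≫ pairing (onHom G hy hx) (𝟙 (y ⟶[V] x)) =
      conv (s ≫ inr V y' y x) ((onHom G hx hy ≫ S x' y') ≫ inl V y' x' x) := by
    rw [conv_inr_inl, pairing, reassoc_of% hs, tensorHom_comp_tensorHom_assoc, hG, Category.comp_id]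
  rw [conv_comp _ _ _ _ _ hc, Category.id_comp, h₃, ← conv_inl_inr, conv_assoc,
    ← conv_assoc ((onHom G hx hy ≫ _) ≫ _), ← h₂, hS.conv_left_of_isComonHom, convUnit,
    Category.assoc, eId_inl, ← convUnit, convUnit_conv, ← h₁]

end

end SemiHopfCat

end

/-! ### The limit category and its universal property -/

noncomputable section

namespace SemiHopfCat

variable {V : Type u} [Category.{v} V] [MonoidalCategory V] [BraidedCategory V]

attribute [local instance] ComonObj.instTensorUnit

variable {J : Type v} [SmallCategory J] (F : J ⥤ SemiHopfCat V)

/-- The limit of the sets of objects of a diagram of semi-Hopf categories. -/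
@[ext]
structure LimObj : Type v where
  /-- The components. -/
  val : ∀ j, (F.obj j).carrier
  property : ∀ {j k : J} (f : j ⟶ k), onObj (F.map f) (val j) = val k

variable {F}

section LimHom

variable [HasLimits V] [HasColimits V] [WellPowered.{v} V] [hV : Fact (VeryFlatTensor V)]

theorem exists_limHom (x y : LimObj F) :
    ∃ L : ComonCone (fun j => x.1 j ⟶[V] y.1 j) (fun f => onHom (F.map f) (x.2 f) (y.2 f)),
      JointlyMonic (comulList L.π) ∧ ∀ D : ComonCone (fun j => x.1 j ⟶[V] y.1 j)
        (fun f => onHom (F.map f) (x.2 f) (y.2 f)), ∃ f : D.pt ⟶ L.pt, IsComonHom f ∧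
          ∀ j, f ≫ L.π j = D.π j :=
  ComonCone.exists_terminal hV.out _ _

/-- The Hom-objects of the limit. -/
def LimHom (x y : LimObj F) : V := (exists_limHom x y).choose.pt

instance limHomComon (x y : LimObj F) : ComonObj (LimHom x y) := (exists_limHom x y).choose.comon

/-- The projections of the Hom-objects of the limit. -/
def limHomπ (x y : LimObj F) (j : J) : LimHom x y ⟶ (x.1 j ⟶[V] y.1 j) :=
  (exists_limHom x y).choose.π j

instance limHomπ_isComonHom (x y : LimObj F) (j : J) : IsComonHom (limHomπ x y j) :=
  (exists_limHom x y).choose.isComonHom j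

theorem limHomπ_onHom (x y : LimObj F) {j k : J} (f : j ⟶ k) :
    limHomπ x y j ≫ onHom (F.map f) (x.2 f) (y.2 f) = limHomπ x y k :=
  (exists_limHom x y).choose.w f

theorem jointlyMonic_limHomπ (x y : LimObj F) : JointlyMonic (comulList (limHomπ x y)) :=
  (exists_limHom x y).choose_spec.1

theorem exists_limHom_lift {x y : LimObj F} {D : V} [ComonObj D]
    (p : ∀ j, D ⟶ (x.1 j ⟶[V] y.1 j)) (hp : ∀ j, IsComonHom (p j))
    (w : ∀ (j k : J) (f : j ⟶ k), p j ≫ onHom (F.map f) (x.2 f) (y.2 f) = p k) :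
    ∃ f : D ⟶ LimHom x y, IsComonHom f ∧ ∀ j, f ≫ limHomπ x y j = p j :=
  (exists_limHom x y).choose_spec.2 ⟨D, p, hp, w _ _⟩

/-- The morphism of comonoids to a Hom-object of the limit induced by a cone. -/
def limHomLift {x y : LimObj F} {D : V} [ComonObj D]
    (p : ∀ j, D ⟶ (x.1 j ⟶[V] y.1 j)) (hp : ∀ j, IsComonHom (p j))
    (w : ∀ (j k : J) (f : j ⟶ k), p j ≫ onHom (F.map f) (x.2 f) (y.2 f) = p k) :
    D ⟶ LimHom x y :=
  (exists_limHom_lift p hp w).choose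

section

variable {x y : LimObj F} {D : V} [ComonObj D]

theorem limHomLift_isComonHom (p : ∀ j, D ⟶ (x.1 j ⟶[V] y.1 j)) (hp : ∀ j, IsComonHom (p j))
    (w : ∀ (j k : J) (f : j ⟶ k), p j ≫ onHom (F.map f) (x.2 f) (y.2 f) = p k) :
    IsComonHom (limHomLift p hp w) :=
  (exists_limHom_lift p hp w).choose_spec.1

theorem limHomLift_π (p : ∀ j, D ⟶ (x.1 j ⟶[V] y.1 j)) (hp : ∀ j, IsComonHom (p j))
    (w : ∀ (j k : J) (f : j ⟶ k), p j ≫ onHom (F.map f) (x.2 f) (y.2 f) = p k) (j : J) :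
    limHomLift p hp w ≫ limHomπ x y j = p j :=
  (exists_limHom_lift p hp w).choose_spec.2 j

theorem limHom_ext (f g : D ⟶ LimHom x y) [IsComonHom f] [IsComonHom g]
    (h : ∀ j, f ≫ limHomπ x y j = g ≫ limHomπ x y j) : f = g :=
  comonHom_ext_of_jointlyMonic (jointlyMonic_limHomπ x y) f g h

end

/-- The composition of the limit. -/
def limComp (x y z : LimObj F) : LimHom x y ⊗ LimHom y z ⟶ LimHom x z :=
  limHomLift (fun j => (limHomπ x y j ⊗ₘ limHomπ y z j) ≫ eComp V _ _ _) inferInstance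
    fun _ _ f => by
      rw [Category.assoc, onHom_comp _ _ (y.2 f), tensorHom_comp_tensorHom_assoc, limHomπ_onHom,
        limHomπ_onHom]

instance (x y z : LimObj F) : IsComonHom (limComp x y z) :=
  limHomLift_isComonHom _ _ _

theorem limComp_π (x y z : LimObj F) (j : J) :
    limComp x y z ≫ limHomπ x z j = (limHomπ x y j ⊗ₘ limHomπ y z j) ≫ eComp V _ _ _ :=
  limHomLift_π _ _ _ j

/-- The identities of the limit. -/
def limId (x : LimObj F) : 𝟙_ V ⟶ LimHom x x :=
  limHomLift (fun j => eId V (x.1 j)) inferInstance fun _ _ _ => onHom_id _ _ _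

instance (x : LimObj F) : IsComonHom (limId x) :=
  limHomLift_isComonHom _ _ _

theorem limId_π (x : LimObj F) (j : J) : limId x ≫ limHomπ x x j = eId V (x.1 j) :=
  limHomLift_π _ _ _ j

theorem limId_limComp (x y : LimObj F) :
    limId x ▷ LimHom x y ≫ limComp x x y = (λ_ _).hom :=
  limHom_ext _ _ fun j => by
    rw [Category.assoc, limComp_π, ← tensorHom_id, tensorHom_comp_tensorHom_assoc, limId_π,
      Category.id_comp, eId_tensorHom_eComp]

theorem limComp_limId (x y : LimObj F) :
    LimHom x y ◁ limId y ≫ limComp x y y = (ρ_ _).hom :=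
  limHom_ext _ _ fun j => by
    rw [Category.assoc, limComp_π, ← id_tensorHom, tensorHom_comp_tensorHom_assoc, limId_π,
      Category.id_comp, tensorHom_eId_eComp]

/-- Both composites are comonoid morphisms, so separatedness reduces the claim to associativity in
each member of the diagram. -/
theorem limComp_assoc (x y z t : LimObj F) :
    (α_ _ _ _).inv ≫ limComp x y z ▷ LimHom z t ≫ limComp x z t =
      LimHom x y ◁ limComp y z t ≫ limComp x y t :=
  limHom_ext _ _ fun j => by
    simp only [Category.assoc, limComp_π]
    rw [← tensorHom_id, ← id_tensorHom, tensorHom_comp_tensorHom_assoc,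
      tensorHom_comp_tensorHom_assoc, limComp_π, limComp_π, Category.id_comp, Category.id_comp,
      tensorHom_eComp_assoc]

variable (F) in
/-- The limit of a diagram of semi-Hopf categories. -/
def limCat : SemiHopfCat V where
  carrier := LimObj F
  enriched :=
    { Hom := LimHom
      id := limId
      comp := limComp
      id_comp x y := by rw [limId_limComp, Iso.inv_hom_id]
      comp_id x y := by rw [limComp_limId, Iso.inv_hom_id]
      assoc := limComp_assoc }
  comon := limHomComon
  comp_comul x y z := by
    have h := IsComonHom.hom_comul (limComp x y z)
    rw [Comon.tensorObj_comul, Category.assoc] at h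
    exact h
  comp_counit x y z := IsComonHom.hom_counit (limComp x y z)
  id_comul x := IsComonHom.hom_comul (limId x)
  id_counit x := IsComonHom.hom_counit (limId x)

/-- The components of the limit cone. -/
def limπ (j : J) : limCat F ⟶ F.obj j :=
  show Hom (limCat F) (F.obj j) from
    { toFunctor :=
        { obj := fun x => x.1 j
          map := fun x y => limHomπ x y j
          map_id := fun x => limId_π x j
          map_comp := fun x y z => limComp_π x y z j }
      isComonHom := fun x y => limHomπ_isComonHom x y j }

theorem onHom_limπ (x y : LimObj F) (j : J) :
    onHom (A := limCat F) (limπ j) (x := x) (y := y) rfl rfl = limHomπ x y j :=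
  onHom_rfl (limπ j) x y

variable (F) in
/-- The limit cone. -/
def limCone : Cone F where
  pt := limCat F
  π :=
    { app := limπ
      naturality := fun j k f => by
        refine (Category.id_comp _).trans (hom_ext (A := limCat F) (B := F.obj k)
          (F := limπ j ≫ F.map f) (G := limπ k) (fun x => x.2 f) fun x y => ?_).symm
        refine (onHom_onHom (limπ j) (F.map f) rfl rfl (x.2 f) (y.2 f) (x.2 f) (y.2 f)).symm.trans ?_
        refine (congrArg (· ≫ _) (onHom_limπ x y j)).trans ?_
        exact (limHomπ_onHom x y f).trans (onHom_limπ x y k).symm }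

section Lift

variable (s : Cone F)

/-- The action on objects of the functor induced by a cone. -/
def liftObj (a : s.pt.carrier) : LimObj F :=
  ⟨fun j => onObj (s.π.app j) a, fun f => congrArg (fun G => onObj G a) (s.w f)⟩

/-- The components of the functor induced by a cone. -/
def liftHom (a b : s.pt.carrier) : (a ⟶[V] b) ⟶ LimHom (liftObj s a) (liftObj s b) :=
  limHomLift (fun j => onHom (s.π.app j) rfl rfl) (fun _ => onHom_isComonHom _ _ _) fun _ _ f =>
    (onHom_onHom (s.π.app _) (F.map f) rfl rfl ((liftObj s a).2 f) ((liftObj s b).2 f)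
      ((liftObj s a).2 f) ((liftObj s b).2 f)).trans (onHom_congr (s.w f) _ _ _ _)

instance (a b : s.pt.carrier) : IsComonHom (liftHom s a b) :=
  limHomLift_isComonHom _ _ _

theorem liftHom_π (a b : s.pt.carrier) (j : J) :
    liftHom s a b ≫ limHomπ _ _ j = onHom (s.π.app j) rfl rfl :=
  limHomLift_π _ _ _ j

theorem liftHom_unique (a b : s.pt.carrier)
    (p : (a ⟶[V] b) ⟶ LimHom (liftObj s a) (liftObj s b)) (_ : IsComonHom p)
    (h : ∀ j, p ≫ limHomπ _ _ j = onHom (s.π.app j) rfl rfl) : p = liftHom s a b :=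
  limHom_ext _ _ fun j => by rw [h, liftHom_π]

theorem eId_liftHom (a : s.pt.carrier) : eId V a ≫ liftHom s a a = limId (liftObj s a) :=
  limHom_ext _ _ fun j => by
    rw [Category.assoc, liftHom_π, limId_π]
    exact onHom_id _ _ _

theorem eComp_liftHom (a b c : s.pt.carrier) :
    eComp V a b c ≫ liftHom s a c =
      (liftHom s a b ⊗ₘ liftHom s b c) ≫ limComp (liftObj s a) (liftObj s b) (liftObj s c) :=
  limHom_ext _ _ fun j => by
    rw [Category.assoc, liftHom_π, Category.assoc, limComp_π, tensorHom_comp_tensorHom_assoc,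
      liftHom_π, liftHom_π]
    exact onHom_comp _ _ _ _

/-- The functor induced by a cone. -/
def limLift : s.pt ⟶ limCat F :=
  show Hom s.pt (limCat F) from
    { toFunctor :=
        { obj := liftObj s
          map := liftHom s
          map_id := eId_liftHom s
          map_comp := eComp_liftHom s }
      isComonHom := fun a b => inferInstanceAs (IsComonHom (liftHom s a b)) }

end Lift

variable (F) in
/-- The limit cone is a limit. -/
def limConeIsLimit : IsLimit (limCone F) where
  lift := limLift
  fac s j := hom_ext (A := s.pt) (B := F.obj j) (F := limLift s ≫ limπ j) (G := s.π.app j)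
    (fun a => rfl) fun a b => by
      refine (onHom_onHom (limLift s) (limπ j) rfl rfl rfl rfl rfl rfl).symm.trans ?_
      refine (congrArg (· ≫ _) (onHom_rfl (limLift s) a b)).trans ?_
      exact (congrArg (_ ≫ ·) (onHom_limπ _ _ j)).trans (liftHom_π s a b j)
  uniq s m hm := by
    have ho : ∀ a, onObj m a = liftObj s a := fun a =>
      LimObj.ext (funext fun j => congrArg (fun G => onObj G a) (hm j))
    refine hom_ext (A := s.pt) (B := limCat F) (F := m) (G := limLift s) ho fun a b => ?_
    refine (liftHom_unique s a b (onHom m (ho a) (ho b)) (onHom_isComonHom m (ho a) (ho b))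
      fun j => ?_).trans (onHom_rfl (limLift s) a b).symm
    refine (congrArg (_ ≫ ·) (onHom_limπ _ _ j)).symm.trans ?_
    refine (onHom_onHom m (limπ j) (ho a) (ho b) rfl rfl ?_ ?_).trans (onHom_congr (hm j) _ _ _ _)
    · exact congrArg (fun G => onObj G a) (hm j)
    · exact congrArg (fun G => onObj G b) (hm j)

theorem hasLimits : HasLimits (SemiHopfCat V) where
  has_limits_of_shape _ _ := ⟨fun F => ⟨⟨⟨limCone F, limConeIsLimit F⟩⟩⟩⟩

end LimHom

end SemiHopfCat

end

/-! ### The antipode of a limit of Hopf categories -/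

noncomputable section

section WordMap

variable {V : Type u} [Category.{v} V] [MonoidalCategory V] {ι : Type v} {X : ι → V}
  {C D : V} [ComonObj D] (p : ∀ j, D ⟶ X j) (u : ∀ j, 𝟙_ V ⟶ X j) (g h : C ⟶ D)

/-- A criterion for morphisms that need not be comonoid morphisms: if projecting the last factor of
the comultiplication always leaves a constant, the factors of a tensor word can be removed one by
one until only the counit is left. -/
theorem comp_comulList_eq_of_right (hε : g ≫ ε[D] = h ≫ ε[D])
    (hg : ∀ j, g ≫ Δ[D] ≫ (𝟙 D ⊗ₘ p j) = g ≫ (ρ_ D).inv ≫ (𝟙 D ⊗ₘ u j))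
    (hh : ∀ j, h ≫ Δ[D] ≫ (𝟙 D ⊗ₘ p j) = h ≫ (ρ_ D).inv ≫ (𝟙 D ⊗ₘ u j)) (l : List ι) :
    g ≫ comulList p l = h ≫ comulList p l := by
  induction l with
  | nil => exact hε
  | cons j l ih =>
    have h₁ : comulList p l ⊗ₘ p j = (𝟙 D ⊗ₘ p j) ≫ (comulList p l ⊗ₘ 𝟙 _) := by
      rw [tensorHom_comp_tensorHom, Category.id_comp, Category.comp_id]
    have h₂ : (ρ_ D).inv ≫ (𝟙 D ⊗ₘ u j) ≫ (comulList p l ⊗ₘ 𝟙 _) =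
        comulList p l ≫ (ρ_ _).inv ≫ (𝟙 _ ⊗ₘ u j) := by
      rw [tensorHom_comp_tensorHom, Category.id_comp, Category.comp_id,
        rightUnitor_inv_naturality_assoc, ← tensorHom_id, tensorHom_comp_tensorHom,
        Category.id_comp, Category.comp_id]
    have h₃ : g ≫ Δ[D] ≫ (comulList p l ⊗ₘ p j) = h ≫ Δ[D] ≫ (comulList p l ⊗ₘ p j) := by
      rw [h₁, reassoc_of% hg j, reassoc_of% hh j, h₂, reassoc_of% ih]
    exact h₃

theorem comp_comulList_eq_of_left (hε : g ≫ ε[D] = h ≫ ε[D])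
    (hg : ∀ j, g ≫ Δ[D] ≫ (p j ⊗ₘ 𝟙 D) = g ≫ (λ_ D).inv ≫ (u j ⊗ₘ 𝟙 D))
    (hh : ∀ j, h ≫ Δ[D] ≫ (p j ⊗ₘ 𝟙 D) = h ≫ (λ_ D).inv ≫ (u j ⊗ₘ 𝟙 D)) (l : List ι) :
    g ≫ comulList p l = h ≫ comulList p l := by
  -- The leftmost tensor factor belongs to the last entry of the list, hence induction from that
  -- end.
  induction l using List.reverseRecOn with
  | nil => exact hε
  | append_singleton l j ih =>
    have h₁ : comulList p [j] ⊗ₘ comulList p l =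
        (p j ⊗ₘ 𝟙 D) ≫ (tensorListSingletonInv j ⊗ₘ comulList p l) := by
      rw [tensorHom_comp_tensorHom, Category.id_comp, comp_tensorListSingletonInv]
    have h₂ : (λ_ D).inv ≫ (u j ⊗ₘ 𝟙 D) ≫ (tensorListSingletonInv j ⊗ₘ comulList p l) =
        comulList p l ≫ (λ_ _).inv ≫ ((u j ≫ tensorListSingletonInv j) ⊗ₘ 𝟙 _) := by
      rw [tensorHom_comp_tensorHom, Category.id_comp, leftUnitor_inv_naturality_assoc,
        ← id_tensorHom, tensorHom_comp_tensorHom, Category.id_comp, Category.comp_id]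
    rw [← comulList_append, h₁]
    simp only [Category.assoc]
    rw [reassoc_of% hg j, reassoc_of% hh j, reassoc_of% h₂, reassoc_of% ih]

end WordMap

namespace SemiHopfCat

open EnrichedProd

variable {V : Type u} [Category.{v} V] [MonoidalCategory V] [BraidedCategory V]

section

variable {L A : SemiHopfCat V} (G : L ⟶ A) {x y : L.carrier} {x' y' : A.carrier}

theorem convUnit_comp_comul_right (C : V) [ComonObj C] (hx : onObj G x = x') :
    convUnit C x ≫ Δ[x ⟶[V] x] ≫ (𝟙 _ ⊗ₘ onHom G hx hx) =
      convUnit C x ≫ (ρ_ _).inv ≫ (𝟙 _ ⊗ₘ eId V x') := by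
  rw [← cancel_mono (tensorToHom V x x x' x')]
  have h₁ := eId_pairing (𝟙 (x ⟶[V] x)) (onHom G hx hx) (Category.comp_id _) (onHom_id G hx hx)
  have h₂ := eId_inl (V := V) x x'
  simp only [convUnit, Category.assoc]
  exact congrArg (ε[C] ≫ ·) (h₁.trans h₂.symm)

theorem convUnit_comp_comul_left (C : V) [ComonObj C] (hx : onObj G x = x') :
    convUnit C x ≫ Δ[x ⟶[V] x] ≫ (onHom G hx hx ⊗ₘ 𝟙 _) =
      convUnit C x ≫ (λ_ _).inv ≫ (eId V x' ⊗ₘ 𝟙 _) := by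
  rw [← cancel_mono (tensorToHom V x' x' x x)]
  have h₁ := eId_pairing (onHom G hx hx) (𝟙 (x ⟶[V] x)) (onHom_id G hx hx) (Category.comp_id _)
  have h₂ := eId_inr (V := V) x' x
  simp only [convUnit, Category.assoc]
  exact congrArg (ε[C] ≫ ·) (h₁.trans h₂.symm)

variable {S : ∀ x y : A.carrier, (x ⟶[V] y) ⟶ (y ⟶[V] x)}

/-- In Sweedler notation, `x₁ s(x₄) ⊗ G(x₂ s(x₃)) = x₁ s(x₂) ⊗ 1`. Only the projected factor needs
to cancel, and there `s` is already known to become an antipode. -/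
theorem conv_comp_comul_right (hS : A.IsAntipode S) (hx : onObj G x = x') (hy : onObj G y = y')
    (s : (x ⟶[V] y) ⟶ (y ⟶[V] x))
    (hs : s ≫ Δ[y ⟶[V] x] = Δ[x ⟶[V] y] ≫ (β_ _ _).hom ≫ (s ⊗ₘ s))
    (hG : s ≫ onHom G hy hx = onHom G hx hy ≫ S x' y') :
    conv (𝟙 _) s ≫ Δ[x ⟶[V] x] ≫ (𝟙 _ ⊗ₘ onHom G hx hx) =
      conv (𝟙 _) s ≫ (ρ_ _).inv ≫ (𝟙 _ ⊗ₘ eId V x') := by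
  rw [← cancel_mono (tensorToHom V x x x' x')]
  simpa only [pairing, inl, Category.assoc] using conv_comp_pairing_onHom_right hS G hx hy s hs hG

theorem conv_comp_comul_left (hS : A.IsAntipode S) (hx : onObj G x = x') (hy : onObj G y = y')
    (s : (x ⟶[V] y) ⟶ (y ⟶[V] x))
    (hs : s ≫ Δ[y ⟶[V] x] = Δ[x ⟶[V] y] ≫ (β_ _ _).hom ≫ (s ⊗ₘ s))
    (hG : s ≫ onHom G hy hx = onHom G hx hy ≫ S x' y') :
    conv s (𝟙 _) ≫ Δ[y ⟶[V] y] ≫ (onHom G hy hy ⊗ₘ 𝟙 _) =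
      conv s (𝟙 _) ≫ (λ_ _).inv ≫ (eId V y' ⊗ₘ 𝟙 _) := by
  rw [← cancel_mono (tensorToHom V y' y' y y)]
  simpa only [pairing, inr, Category.assoc] using conv_comp_pairing_onHom_left hS G hx hy s hs hG

theorem conv_comp_counit {C : V} [ComonObj C] {x y z : L.carrier} (f : C ⟶ (x ⟶[V] y))
    (g : C ⟶ (y ⟶[V] z)) (hf : f ≫ ε = ε[C]) (hg : g ≫ ε = ε[C]) : conv f g ≫ ε = ε[C] := by
  rw [conv, Category.assoc, Category.assoc, L.comp_counit, tensorHom_comp_tensorHom_assoc, hf, hg,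
    ComonObj.counit_comul_hom_assoc, Iso.inv_hom_id, Category.comp_id]

theorem convUnit_comp_counit (C : V) [ComonObj C] (x : L.carrier) : convUnit C x ≫ ε = ε[C] := by
  rw [convUnit, Category.assoc, L.id_counit, Category.comp_id]

end

variable {J : Type v} [SmallCategory J] {F : J ⥤ SemiHopfCat V}
  [HasLimits V] [HasColimits V] [WellPowered.{v} V] [Fact (VeryFlatTensor V)]

theorem jointlyMonic_onHom_limπ (x y : (limCat F).carrier) :
    JointlyMonic (comulList fun j => onHom (limπ j) (rfl : onObj (limπ j) x = _)
      (rfl : onObj (limπ j) y = _)) := by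
  have h := jointlyMonic_limHomπ x y
  have h' : limHomπ x y = fun j => onHom (limπ j) (rfl : onObj (limπ j) x = _)
      (rfl : onObj (limπ j) y = _) := funext fun j => (onHom_limπ x y j).symm
  rw [h'] at h
  exact h

/-- The antipodes of the members of the diagram induce morphisms between the Hom-objects of the
limit which reverse comultiplications. -/
theorem exists_limAntipode {S : ∀ j, ∀ a b : (F.obj j).carrier, (a ⟶[V] b) ⟶ (b ⟶[V] a)}
    (hS : ∀ j, (F.obj j).IsAntipode (S j)) (x y : LimObj F) :
    ∃ s : LimHom x y ⟶ LimHom y x, s ≫ ε = ε ∧ s ≫ Δ = Δ ≫ (β_ _ _).hom ≫ (s ⊗ₘ s) ∧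
      ∀ j, s ≫ limHomπ y x j = limHomπ x y j ≫ S j (x.1 j) (y.1 j) := by
  let D : ComonCone (fun j => y.1 j ⟶[V] x.1 j) (fun f => onHom (F.map f) (y.2 f) (x.2 f)) :=
    { pt := LimHom x y
      -- Since each antipode reverses comultiplication, it is a comonoid morphism only from the
      -- co-opposite.
      comon := copComon _
      π := fun j => limHomπ x y j ≫ S j (x.1 j) (y.1 j)
      isComonHom := fun j => isComonHom_copComon _
        (by rw [Category.assoc, (hS j).comp_counit, IsComonHom.hom_counit])
        (by rw [Category.assoc, (hS j).comp_comul, IsComonHom.hom_comul_assoc,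
          BraidedCategory.braiding_naturality_assoc, tensorHom_comp_tensorHom])
      w := fun {j k} f => by
        rw [Category.assoc, (hS j).comp_onHom (hS k), reassoc_of% limHomπ_onHom x y f] }
  obtain ⟨s, hs, h⟩ := (exists_limHom y x).choose_spec.2 D
  exact ⟨s, hs.hom_counit, hs.hom_comul.trans (Category.assoc _ _ _), h⟩

/-- The two sides of an antipode law cannot be compared with `limHom_ext`, which needs comonoid
morphisms. Instead both satisfy the hypotheses of `comp_comulList_eq_of_right`, or of its mirror
image, so they agree on every tensor word. -/
theorem isHopf_limCat {S : ∀ j, ∀ a b : (F.obj j).carrier, (a ⟶[V] b) ⟶ (b ⟶[V] a)}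
    (hS : ∀ j, (F.obj j).IsAntipode (S j)) : isHopf V (limCat F) := by
  -- The projections are rewritten as components of the semi-Hopf functors `limπ j`, to which the
  -- cancellation lemmas apply.
  have h : ∀ x y : (limCat F).carrier, ∃ s : (x ⟶[V] y) ⟶ (y ⟶[V] x), s ≫ ε = ε ∧
      s ≫ Δ = Δ ≫ (β_ _ _).hom ≫ (s ⊗ₘ s) ∧
      ∀ j, s ≫ onHom (limπ j) rfl rfl = onHom (limπ j) rfl rfl ≫ S j _ _ := by
    intro x y
    obtain ⟨s, h₁, h₂, h₃⟩ := exists_limAntipode hS x y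
    refine ⟨s, h₁, h₂, fun j => ?_⟩
    refine (congrArg (s ≫ ·) (onHom_limπ y x j)).trans ((h₃ j).trans ?_)
    exact congrArg (· ≫ S j (x.1 j) (y.1 j)) (onHom_limπ x y j).symm
  choose s h₁ h₂ h₃ using h
  refine ⟨s, IsAntipode.of_conv (fun x y => ?_) (fun x y => ?_)⟩
  · refine jointlyMonic_onHom_limπ x x _ _ (comp_comulList_eq_of_right _
      (fun j => eId V (onObj (limπ j) x)) _ _ ?_ (fun j => ?_) fun j => ?_)
    · rw [conv_comp_counit _ _ (Category.id_comp _) (h₁ x y), convUnit_comp_counit]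
    · exact conv_comp_comul_right (limπ j) (hS j) rfl rfl (s x y) (h₂ x y) (h₃ x y j)
    · exact convUnit_comp_comul_right (limπ j) _ rfl
  · refine jointlyMonic_onHom_limπ y y _ _ (comp_comulList_eq_of_left _
      (fun j => eId V (onObj (limπ j) y)) _ _ ?_ (fun j => ?_) fun j => ?_)
    · rw [conv_comp_counit _ _ (h₁ x y) (Category.id_comp _), convUnit_comp_counit]
    · exact conv_comp_comul_left (limπ j) (hS j) rfl rfl (s x y) (h₂ x y) (h₃ x y j)
    · exact convUnit_comp_comul_left (limπ j) _ rfl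

variable (V) in
theorem isHopf_isClosedUnderLimitsOfShape (J : Type v) [SmallCategory J] :
    (isHopf V).IsClosedUnderLimitsOfShape J where
  limitsOfShape_le := by
    rintro X ⟨p⟩
    choose S hS using p.prop_diag_obj
    exact (isHopf V).prop_of_iso
      ((limConeIsLimit p.diag).conePointUniqueUpToIso p.isLimit) (isHopf_limCat hS)

variable (V) in
theorem hopfCat_hasLimits : HasLimits (HopfCat V) where
  has_limits_of_shape J _ := by
    have := isHopf_isClosedUnderLimitsOfShape V J
    have := hasLimits (V := V)
    infer_instance

variable (V) in
theorem hopfCat_preservesLimits : PreservesLimits (isHopf V).ι where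
  preservesLimitsOfShape {J} _ := by
    have := isHopf_isClosedUnderLimitsOfShape V J
    have := hasLimits (V := V)
    infer_instance

end SemiHopfCat

end

theorem proposition3p4 (V : Type u) [Category.{v} V] [MonoidalCategory V] [SymmetricCategory V]
    [IsLocallyPresentable.{v} V] :
    (∀ [MonoidalClosed V],
      HasColimits (HopfCat V) ∧
      PreservesColimits (isHopf V).ι ∧
      ∀ (J : Type v) [SmallCategory J], (isHopf V).IsClosedUnderColimitsOfShape J) ∧
    (VeryFlatTensor V →
      HasLimits (HopfCat V) ∧
      PreservesLimits (isHopf V).ι ∧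
      ∀ (J : Type v) [SmallCategory J], (isHopf V).IsClosedUnderLimitsOfShape J) := by
  have := IsLocallyPresentable.hasColimits V
  refine ⟨⟨SemiHopfCat.hopfCat_hasColimits, SemiHopfCat.hopfCat_preservesColimits,
    fun J _ => SemiHopfCat.isHopf_isClosedUnderColimitsOfShape J⟩, fun hV => ?_⟩
  have := IsLocallyPresentable.hasLimits V
  have := IsLocallyPresentable.wellPowered V
  have : Fact (VeryFlatTensor V) := ⟨hV⟩
  exact ⟨SemiHopfCat.hopfCat_hasLimits V, SemiHopfCat.hopfCat_preservesLimits V,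
    SemiHopfCat.isHopf_isClosedUnderLimitsOfShape V⟩
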